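/- Let $G=(V,E)$ be a finite simple graph with a set of boundary vertices $V_\partial\subseteq V$. To each edge $e$ assign $D_e\in\mathbb N$ and to each half-edge $(e,x)$ (an edge $e$ with an endpoint $x$) the Hilbert space $\mathcal H_{e,x}=\mathbb C^{D_e}$; for $S\subseteq V$ let $\mathcal H_S=\bigotimes_{(e,x):x\in S}\mathcal H_{e,x}$. Let $\phi=|\phi\rangle\langle\phi|$ be a link state, i.e. $|\phi\rangle=\bigotimes_{e\in E}|\phi_e\rangle\in\mathcal H_V$ with $|\phi_e\rangle=\sum_{i=1}^{D_e}\sqrt{\lambda_{e,i}}\,|ii\rangle\in\mathcal H_{e,x}\otimes\mathcal H_{e,y}$ for $e=(xy)$, where $\lambda_{e,i}\ge 0$ and $\sum_i\lambda_{e,i}=1$. Write $\mathcal P_\le(\mathcal H)$ for the positive semidefinite operators on $\mathcal H$ of trace at most $1$. For $\rho,\sigma\in\mathcal P_\le(\mathcal H)$ the purified distance is $P(\rho,\sigma)=\sqrt{1-F_*(\rho,\sigma)^2}$ with $F_*(\rho,\sigma)=\|\sqrt\rho\sqrt\sigma\|_1+\sqrt{(1-\operatorname{tr}\rho)(1-\operatorname{tr}\sigma)}$.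 For $\rho_{AB}\in\mathcal P_\le(\mathcal H_A\otimes\mathcal H_B)$ let $$H_{\min}(A|B)_\rho=\sup_{\sigma\in\mathcal P_\le(\mathcal H_B)}\bigl(-\inf\{t\in\mathbb R:\rho_{AB}\le 2^t\, I_A\otimes\sigma\}\bigr),\qquad H^\varepsilon_{\min}(A|B)_\rho=\sup_{\rho'\in\mathcal P_\le(\mathcal H_A\otimes\mathcal H_B),\ P(\rho',\rho_{AB})\le\varepsilon}H_{\min}(A|B)_{\rho'},$$ with values in $[-\infty,\infty]$; for a state on a larger system the reduced state $\rho_{AB}$ is meant. Let $A\subseteq V_\partial$. A cut for $A$ is a set $\Gamma\subseteq V$ with $\Gamma\cap V_\partial=A$. Let $\Gamma_A$ be a cut for $A$, put $\Gamma_A^c=V\setminus\Gamma_A$, and let $\mathcal C_1(\Gamma_A)$ and $\mathcal C_2(\Gamma_A)$ be the sets of the cuts $\Delta_A$ for $A$ with $\Delta_A\subsetneq\Gamma_A$ and with $\Gamma_A\subsetneq\Delta_A$, respectively. Then for every $\varepsilon\ge 0$ there is a pure subnormalized state $\phi^\varepsilon=|\phi^\varepsilon\rangle\langle\phi^\varepsilon|\in\mathcal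 P_\le(\mathcal H_V)$ (a vector of norm at most $1$, possibly zero) such that $$P(\phi,\phi^\varepsilon)\le 2\left(\sqrt{|\mathcal C_1(\Gamma_A)|}+\sqrt{|\mathcal C_2(\Gamma_A)|}\right)\sqrt\varepsilon,$$ and simultaneously $$H_{\min}(\Gamma_A\setminus\Delta_A\,|\,\Gamma_A^c)_{\phi^\varepsilon}\ge H^\varepsilon_{\min}(\Gamma_A\setminus\Delta_A\,|\,\Gamma_A^c)_{\phi}\quad\text{for all }\Delta_A\in\mathcal C_1(\Gamma_A),$$ $$H_{\min}(\Delta_A\setminus\Gamma_A\,|\,\Gamma_A)_{\phi^\varepsilon}\ge H^\varepsilon_{\min}(\Delta_A\setminus\Gamma_A\,|\,\Gamma_A)_{\phi}\quad\text{for all }\Delta_A\in\mathcal C_2(\Gamma_A).$$ -/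

import Mathlib

open scoped ComplexOrder MatrixOrder Kronecker

namespace LinkStates

noncomputable section

/-! ### States on finite-dimensional systems

A system is given by a finite type `a` labelling its standard orthonormal basis; its operators are
the matrices `Matrix a a ℂ`, with the Loewner order. All logarithms are to base two. -/

section States

variable {a b : Type*} [Fintype a] [DecidableEq a] [Fintype b] [DecidableEq b]

/-- Positive semidefinite operators with trace at most one. -/
def subnormalizedStates (a : Type*) [Fintype a] : Set (Matrix a a ℂ) :=
  {ρ | ρ.PosSemidef ∧ ρ.trace.re ≤ 1}

/-- The operator `|ψ⟩⟨ψ|`. -/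
def pureState (ψ : a → ℂ) : Matrix a a ℂ :=
  Matrix.vecMulVec ψ (star ψ)

/-- The trace norm `‖X‖₁ = tr √(X† X)`. -/
def traceNorm (X : Matrix a a ℂ) : ℝ :=
  (CFC.sqrt (X.conjTranspose * X)).trace.re

/-- The fidelity `F(ρ, σ) = ‖√ρ √σ‖₁`. -/
def fidelity (ρ σ : Matrix a a ℂ) : ℝ :=
  traceNorm (CFC.sqrt ρ * CFC.sqrt σ)

/-- The generalized fidelity `F_*(ρ, σ)` of subnormalized states. -/
def generalizedFidelity (ρ σ : Matrix a a ℂ) : ℝ :=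
  fidelity ρ σ + √((1 - ρ.trace.re) * (1 - σ.trace.re))

/-- The purified distance of subnormalized states. -/
def purifiedDistance (ρ σ : Matrix a a ℂ) : ℝ :=
  √(1 - generalizedFidelity ρ σ ^ 2)

/-- The conditional min-entropy `H_min(A|B)_{ρ|σ} = - inf {t : ρ_AB ≤ 2^t I_A ⊗ σ_B}`, with
`inf ∅ = ∞`. -/
def condMinEntropyRel (ρ : Matrix (a × b) (a × b) ℂ) (σ : Matrix b b ℂ) : EReal :=
  -(⨅ (t : ℝ) (_ : ρ ≤ ((2 : ℝ) ^ t) • ((1 : Matrix a a ℂ) ⊗ₖ σ)), (t : EReal))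

/-- The conditional min-entropy `H_min(A|B)_ρ`. -/
def condMinEntropy (ρ : Matrix (a × b) (a × b) ℂ) : EReal :=
  ⨆ σ ∈ subnormalizedStates b, condMinEntropyRel ρ σ

/-- The smooth conditional min-entropy `H_min^ε(A|B)_ρ`. -/
def smoothCondMinEntropy (ε : ℝ) (ρ : Matrix (a × b) (a × b) ℂ) : EReal :=
  ⨆ ρ' ∈ subnormalizedStates (a × b), ⨆ (_ : purifiedDistance ρ' ρ ≤ ε), condMinEntropy ρ'

end States

/-! ### Link states on a graph -/

section Graph

variable {V : Type*} [Fintype V] [DecidableEq V] (G : SimpleGraph V) [DecidableRel G.Adj]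

/-- The half-edges `(e, x)`: an edge `e` together with an endpoint `x` of `e`. -/
abbrev HalfEdge : Type _ := Σ e : G.edgeSet, {x : V // x ∈ (e : Sym2 V)}

variable {G} (D : G.edgeSet → ℕ)

/-- The standard product basis of `H_V`, the tensor product of `H_{e,x} = ℂ^{D_e}` over all
half-edges. -/
abbrev Config : Type _ := (h : HalfEdge G) → Fin (D h.1)

/-- The standard product basis of `H_S`, the tensor product of `H_{e,x}` over all half-edges
`(e, x)` with `x ∈ S`. -/
abbrev SubConfig (S : Finset V) : Type _ :=
  (h : {h : HalfEdge G // h.2.1 ∈ S}) → Fin (D h.1.1)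

variable {D}

/-- Basis elements of `H_S`, of `H_T` and of the rest combine to a basis element of `H_V`. -/
def join (S T : Finset V) (s : SubConfig D S) (t : SubConfig D T) (r : SubConfig D (S ∪ T)ᶜ) :
    Config D := fun h =>
  if hS : h.2.1 ∈ S then s ⟨h, hS⟩
  else if hT : h.2.1 ∈ T then t ⟨h, hT⟩
  else r ⟨h, by simp [hS, hT]⟩

/-- For disjoint `S` and `T`: the reduced state of `ρ` on the bipartite system `H_S ⊗ H_T`, the
partial trace over all the other half-edges. -/
def reducedState (ρ : Matrix (Config D) (Config D) ℂ) (S T : Finset V) :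
    Matrix (SubConfig D S × SubConfig D T) (SubConfig D S × SubConfig D T) ℂ :=
  fun p q => ∑ r : SubConfig D (S ∪ T)ᶜ, ρ (join S T p.1 p.2 r) (join S T q.1 q.2 r)

/-- The vector `|φ_e⟩ = ∑ i, √(λ i) |i i⟩` of `H_e`, whose basis elements assign a label to each
endpoint of `e`. -/
def edgeVector (e : G.edgeSet) (lam : Fin (D e) → ℝ) :
    ({x : V // x ∈ (e : Sym2 V)} → Fin (D e)) → ℂ :=
  ∑ i : Fin (D e), ((√(lam i) : ℝ) : ℂ) • Pi.single (fun _ => i) (1 : ℂ)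

/-- The tensor product `|φ⟩` of the vectors `|φ_e⟩` over all edges. -/
def linkVector (lam : (e : G.edgeSet) → Fin (D e) → ℝ) : Config D → ℂ :=
  fun c => ∏ e : G.edgeSet, edgeVector e (lam e) (fun x => c ⟨e, x⟩)

/-- The link state `φ = |φ⟩⟨φ|` with Schmidt coefficients `√(λ_{e,i})`. -/
def linkState (lam : (e : G.edgeSet) → Fin (D e) → ℝ) : Matrix (Config D) (Config D) ℂ :=
  pureState (linkVector lam)

/-- The cuts for `A`: vertex sets which meet the boundary exactly in `A`. -/
def cuts (bdry A : Finset V) : Finset (Finset V) :=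
  Finset.univ.filter fun Γ => Γ ∩ bdry = A

/-- The cuts for `A` strictly contained in `Γ`. -/
def smallerCuts (bdry A Γ : Finset V) : Finset (Finset V) :=
  (cuts bdry A).filter fun Δ => Δ ⊂ Γ

/-- The cuts for `A` strictly containing `Γ`. -/
def largerCuts (bdry A Γ : Finset V) : Finset (Finset V) :=
  (cuts bdry A).filter fun Δ => Γ ⊂ Δ

end Graph

end

end LinkStates

open LinkStates

/-! Smoothing each cut separately gives unrelated states; a common state exists because, for link
states, smoothing can be replaced by filtering in the label basis, and such filters commute. The
link state is `∑ x, linkAmp x |diag x⟩` over edge labels `x`, and a filter multiplies the amplitudes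
by some `Q` with `0 ≤ Q ≤ 1`.

Fix disjoint `S`, `T` and a smoothing `ρ' ≤ l (1 ⊗ σ)` of the reduced state. Its components `coeff`
along the label basis have total weight at most one and overlap with the true amplitudes at least as
much as the fidelity. Truncating each amplitude to the modulus of its component gives a filter that
loses weight at most `2ε` and inherits a bound with the same `l` (`exists_isFilter`). Phases do no
harm since `1 ⊗ σ` is diagonal in the labels seen by `S`. Compactness yields one filter serving all
smoothings (`exists_optimal_filter`).

This filter reads only edges touching `Tᶜ`. Its bound survives further filters on edges touching
`Tᶜ`, which only shrink coefficients, and filters on edges touching `T`, which act as a contraction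
on `T` and are absorbed into `σ` (`IsFilter.ampState_le`). With `T = Γᶜ` for the smaller cuts and `T
= Γ` for the larger ones, every filter is of an admissible kind for every cut, so their product
serves all of them. The losses add up and bound the purified distance. -/

namespace LinkStates

set_option linter.unusedSectionVars false

/-! ### Quadratic forms, orthonormal families and fidelity. -/

section MatrixLemmas

open Matrix

variable {ι κ : Type*} [Fintype ι] [DecidableEq ι] [Fintype κ] [DecidableEq κ]

/-- The quadratic form `⟨v|M|v⟩` of a Hermitian matrix. -/
noncomputable def quadForm (M : Matrix ι ι ℂ) (v : ι → ℂ) : ℝ := (star v ⬝ᵥ M *ᵥ v).re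

lemma star_dotProduct_self (v : ι → ℂ) : star v ⬝ᵥ v = ((∑ i, ‖v i‖ ^ 2 : ℝ) : ℂ) := by
  simp [dotProduct, Complex.conj_mul']

lemma norm_star_dotProduct_sq_le (u v : ι → ℂ) :
    ‖star u ⬝ᵥ v‖ ^ 2 ≤ (∑ i, ‖u i‖ ^ 2) * ∑ i, ‖v i‖ ^ 2 := by
  have h1 : ‖star u ⬝ᵥ v‖ ≤ ∑ i, ‖u i‖ * ‖v i‖ := by
    refine (norm_sum_le _ _).trans (Finset.sum_le_sum fun i _ => ?_)
    simp
  calc ‖star u ⬝ᵥ v‖ ^ 2 ≤ (∑ i, ‖u i‖ * ‖v i‖) ^ 2 := by gcongr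
    _ ≤ _ := Finset.sum_mul_sq_le_sq_mul_sq _ _ _

lemma star_dotProduct_conjTranspose_mul_mulVec (B : Matrix κ ι ℂ) (u v : ι → ℂ) :
    star u ⬝ᵥ (Bᴴ * B) *ᵥ v = star (B *ᵥ u) ⬝ᵥ (B *ᵥ v) := by
  rw [← mulVec_mulVec, dotProduct_mulVec, star_mulVec]

lemma quadForm_conjTranspose_mul_self (B : Matrix κ ι ℂ) (v : ι → ℂ) :
    quadForm (Bᴴ * B) v = ∑ i, ‖(B *ᵥ v) i‖ ^ 2 := by
  rw [quadForm, star_dotProduct_conjTranspose_mul_mulVec, star_dotProduct_self, Complex.ofReal_re]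

lemma exists_conjTranspose_mul_self {M : Matrix ι ι ℂ} (hM : M.PosSemidef) :
    ∃ B : Matrix ι ι ℂ, M = Bᴴ * B :=
  ⟨CFC.sqrt M, by
    rw [(Matrix.nonneg_iff_posSemidef.1 (CFC.sqrt_nonneg M)).isHermitian.eq,
      CFC.sqrt_mul_sqrt_self _ (Matrix.nonneg_iff_posSemidef.2 hM)]⟩

lemma quadForm_nonneg {M : Matrix ι ι ℂ} (hM : M.PosSemidef) (v : ι → ℂ) : 0 ≤ quadForm M v := by
  obtain ⟨B, rfl⟩ := exists_conjTranspose_mul_self hM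
  rw [quadForm_conjTranspose_mul_self]
  positivity

lemma norm_star_dotProduct_mulVec_sq_le {M : Matrix ι ι ℂ} (hM : M.PosSemidef) (u v : ι → ℂ) :
    ‖star u ⬝ᵥ M *ᵥ v‖ ^ 2 ≤ quadForm M u * quadForm M v := by
  obtain ⟨B, rfl⟩ := exists_conjTranspose_mul_self hM
  rw [quadForm_conjTranspose_mul_self, quadForm_conjTranspose_mul_self,
    star_dotProduct_conjTranspose_mul_mulVec]
  exact norm_star_dotProduct_sq_le _ _

lemma star_dotProduct_mulVec_self {M : Matrix ι ι ℂ} (hM : M.PosSemidef) (v : ι → ℂ) :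
    star v ⬝ᵥ M *ᵥ v = (quadForm M v : ℂ) := by
  obtain ⟨B, rfl⟩ := exists_conjTranspose_mul_self hM
  rw [quadForm_conjTranspose_mul_self, star_dotProduct_conjTranspose_mul_mulVec,
    star_dotProduct_self]

lemma quadForm_mono {M N : Matrix ι ι ℂ} (h : M ≤ N) (v : ι → ℂ) :
    quadForm M v ≤ quadForm N v := by
  have := (Matrix.le_iff.1 h).dotProduct_mulVec_nonneg v
  rw [sub_mulVec, dotProduct_sub] at this
  have := (Complex.le_def.1 this).1
  simp only [Complex.sub_re, Complex.zero_re] at this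
  simp only [quadForm]
  linarith

lemma le_of_quadForm_le {M N : Matrix ι ι ℂ} (hM : M.PosSemidef) (hN : N.PosSemidef)
    (h : ∀ v, quadForm M v ≤ quadForm N v) : M ≤ N := by
  rw [Matrix.le_iff, posSemidef_iff_dotProduct_mulVec]
  refine ⟨hN.isHermitian.sub hM.isHermitian, fun v => ?_⟩
  rw [sub_mulVec, dotProduct_sub, star_dotProduct_mulVec_self hM, star_dotProduct_mulVec_self hN,
    ← Complex.ofReal_sub]
  exact_mod_cast sub_nonneg.2 (h v)

lemma quadForm_sum {τ : Type*} (s : Finset τ) (M : τ → Matrix ι ι ℂ) (v : ι → ℂ) :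
    quadForm (∑ k ∈ s, M k) v = ∑ k ∈ s, quadForm (M k) v := by
  simp [quadForm, sum_mulVec, dotProduct_sum]

lemma quadForm_smul (r : ℝ) (M : Matrix ι ι ℂ) (v : ι → ℂ) :
    quadForm (r • M) v = r * quadForm M v := by
  simp [quadForm, smul_mulVec, dotProduct_smul]

lemma quadForm_pureState (u v : ι → ℂ) : quadForm (pureState u) v = ‖star u ⬝ᵥ v‖ ^ 2 := by
  have h : star v ⬝ᵥ u = star (star u ⬝ᵥ v) := star_dotProduct v u
  rw [quadForm, pureState, vecMulVec_mulVec, dotProduct_smul, h]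
  simp only [MulOpposite.smul_eq_mul_unop, MulOpposite.unop_op, RCLike.star_def, Complex.conj_mul']
  exact_mod_cast Complex.ofReal_re _

lemma pureState_posSemidef (u : ι → ℂ) : (pureState u).PosSemidef :=
  posSemidef_vecMulVec_self_star u

lemma trace_pureState (u : ι → ℂ) : (pureState u).trace = ((∑ i, ‖u i‖ ^ 2 : ℝ) : ℂ) := by
  rw [pureState, trace_vecMulVec, dotProduct_comm, star_dotProduct_self]

lemma quadForm_one_kronecker (M : Matrix κ κ ℂ) (v : ι × κ → ℂ) :
    quadForm ((1 : Matrix ι ι ℂ) ⊗ₖ M) v = ∑ i, quadForm M fun k => v (i, k) := by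
  simp only [quadForm, dotProduct, mulVec, Fintype.sum_prod_type, kroneckerMap_apply, one_apply,
    ite_mul, one_mul, zero_mul, Complex.re_sum, Pi.star_apply]
  refine Finset.sum_congr rfl fun i _ => Finset.sum_congr rfl fun k _ => ?_
  congr 2
  rw [Finset.sum_comm]
  simp

/-- An orthonormal family of vectors. -/
def OrthonormalVecs (e : κ → ι → ℂ) : Prop :=
  ∀ k l, star (e k) ⬝ᵥ e l = if k = l then 1 else 0

lemma OrthonormalVecs.bessel {e : κ → ι → ℂ} (he : OrthonormalVecs e) (x : ι → ℂ) :
    ∑ k, ‖star (e k) ⬝ᵥ x‖ ^ 2 ≤ ∑ i, ‖x i‖ ^ 2 := by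
  have ho : Orthonormal ℂ fun k => WithLp.toLp 2 (e k) := by
    rw [orthonormal_iff_ite]
    intro k l
    rw [EuclideanSpace.inner_toLp_toLp, dotProduct_comm, he]
  have := ho.sum_inner_products_le (WithLp.toLp 2 x) (s := Finset.univ)
  simpa [EuclideanSpace.inner_toLp_toLp, EuclideanSpace.norm_sq_eq, dotProduct_comm] using this

/-- Bessel's inequality for each row of a factor `B` with `M = Bᴴ * B`. -/
lemma OrthonormalVecs.sum_quadForm_le_trace {e : κ → ι → ℂ} (he : OrthonormalVecs e)
    {M : Matrix ι ι ℂ} (hM : M.PosSemidef) : ∑ k, quadForm M (e k) ≤ M.trace.re := by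
  obtain ⟨B, rfl⟩ := exists_conjTranspose_mul_self hM
  have h1 : (Bᴴ * B).trace.re = ∑ i, ∑ j, ‖B i j‖ ^ 2 := by
    simp only [trace, diag_apply, mul_apply, conjTranspose_apply, Complex.re_sum]
    rw [Finset.sum_comm]
    refine Finset.sum_congr rfl fun i _ => Finset.sum_congr rfl fun j _ => ?_
    rw [RCLike.star_def, Complex.conj_mul']
    exact_mod_cast Complex.ofReal_re _
  rw [h1]
  simp only [quadForm_conjTranspose_mul_self]
  rw [Finset.sum_comm]
  refine Finset.sum_le_sum fun i _ => ?_
  have := he.bessel (star (B i))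
  have h2 : ∀ k, ‖(B *ᵥ e k) i‖ = ‖star (e k) ⬝ᵥ star (B i)‖ := fun k => by
    have h3 : star (e k) ⬝ᵥ star (B i) = star ((B *ᵥ e k) i) := (star_dotProduct_star _ _).trans rfl
    rw [h3, norm_star]
  simpa [h2] using this

lemma pureState_mul_pureState (u v : ι → ℂ) :
    pureState u * pureState v = (star u ⬝ᵥ v) • vecMulVec u (star v) := by
  rw [pureState, pureState, vecMulVec_mul_vecMulVec, vecMulVec_smul]

lemma OrthonormalVecs.sum_mul_sum {e : κ → ι → ℂ} (he : OrthonormalVecs e) (p q : κ → ℝ) :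
    (∑ k, p k • pureState (e k)) * (∑ k, q k • pureState (e k)) =
      ∑ k, (p k * q k) • pureState (e k) := by
  rw [Finset.sum_mul]
  refine Finset.sum_congr rfl fun k _ => ?_
  rw [Finset.mul_sum, Finset.sum_eq_single k]
  · rw [smul_mul_smul_comm, pureState_mul_pureState, he, if_pos rfl, one_smul]; rfl
  · intro l _ hl
    rw [smul_mul_smul_comm, pureState_mul_pureState, he, if_neg hl.symm, zero_smul, smul_zero]
  · simp

lemma OrthonormalVecs.sqrt_sum {e : κ → ι → ℂ} (he : OrthonormalVecs e) (p : κ → ℝ)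
    (hp : ∀ k, 0 ≤ p k) :
    CFC.sqrt (∑ k, (p k ^ 2) • pureState (e k)) = ∑ k, p k • pureState (e k) := by
  refine CFC.sqrt_unique ?_ ?_
  · simp only [he.sum_mul_sum, ← sq]
  · exact Finset.sum_nonneg fun k _ => smul_nonneg (hp k)
      (Matrix.nonneg_iff_posSemidef.2 (pureState_posSemidef _))

lemma fidelity_nonneg (ρ σ : Matrix ι ι ℂ) : 0 ≤ fidelity ρ σ := by
  have : (CFC.sqrt ((CFC.sqrt ρ * CFC.sqrt σ)ᴴ * (CFC.sqrt ρ * CFC.sqrt σ))).PosSemidef :=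
    Matrix.nonneg_iff_posSemidef.1 (CFC.sqrt_nonneg _)
  exact (Complex.le_def.1 this.trace_nonneg).1

lemma mulVec_eq_zero_of_quadForm_sq {Y : Matrix ι ι ℂ} (hY : Y.IsHermitian) {v : ι → ℂ}
    (h : (Y * Y) *ᵥ v = 0) : Y *ᵥ v = 0 := by
  have h1 : quadForm (Yᴴ * Y) v = 0 := by rw [hY.eq, quadForm, h]; simp
  rw [quadForm_conjTranspose_mul_self,
    Finset.sum_eq_zero_iff_of_nonneg (fun _ _ => by positivity)] at h1
  ext i
  simpa using h1 i (Finset.mem_univ i)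

lemma trace_mul_pureState (M : Matrix ι ι ℂ) (u : ι → ℂ) :
    (M * pureState u).trace = star u ⬝ᵥ M *ᵥ u := by
  rw [pureState, mul_vecMulVec, trace_vecMulVec, dotProduct_comm]

/-- An upper bound for the fidelity with a state given by its spectral decomposition. -/
lemma OrthonormalVecs.fidelity_le {e : κ → ι → ℂ} (he : OrthonormalVecs e) (p : κ → ℝ)
    (hp : ∀ k, 0 ≤ p k) {ρ' : Matrix ι ι ℂ} (hρ' : ρ'.PosSemidef) :
    fidelity ρ' (∑ k, (p k ^ 2) • pureState (e k)) ≤ ∑ k, p k * √(quadForm ρ' (e k)) := by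
  have hs := he.sqrt_sum p hp
  set R := ∑ k, p k • pureState (e k) with hR
  set S := CFC.sqrt ρ' with hS
  have hSS : S * S = ρ' := CFC.sqrt_mul_sqrt_self _ (Matrix.nonneg_iff_posSemidef.2 hρ')
  have hSh : Sᴴ = S :=
    (Matrix.nonneg_iff_posSemidef.1 (CFC.sqrt_nonneg ρ')).isHermitian.eq
  rw [fidelity, traceNorm, hs]
  set X := S * R with hX
  set Y := CFC.sqrt (Xᴴ * X) with hYdef
  have hYY : Y * Y = Xᴴ * X :=
    CFC.sqrt_mul_sqrt_self _ (Matrix.nonneg_iff_posSemidef.2 (posSemidef_conjTranspose_mul_self X))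
  have hYp : Y.PosSemidef := Matrix.nonneg_iff_posSemidef.1 (CFC.sqrt_nonneg _)
  set P : Matrix ι ι ℂ := ∑ k, pureState (e k) with hP
  have hRP : R * P = R := by
    simpa [hR, hP] using he.sum_mul_sum p 1
  -- `P` projects onto the span of the `e k`; `Y = |X|` has the same kernel as `X = S * R`, and `R *
  -- P = R`.
  have hYP : Y * P = Y := by
    have hz : Y * (1 - P) = 0 := by
      refine Matrix.ext_of_mulVec_single fun i => ?_
      rw [← mulVec_mulVec, Matrix.zero_mulVec]
      refine mulVec_eq_zero_of_quadForm_sq hYp.isHermitian ?_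
      rw [mulVec_mulVec, hYY, hX, mul_assoc, mul_assoc, mul_sub, mul_one, hRP, sub_self,
        mul_zero, mul_zero, Matrix.zero_mulVec]
    rw [mul_sub, mul_one, sub_eq_zero] at hz
    exact hz.symm
  have hRe : ∀ k, R *ᵥ e k = p k • e k := fun k => by
    simp only [hR, sum_mulVec, smul_mulVec, pureState, vecMulVec_mulVec, he _ _]
    rw [Finset.sum_eq_single k]
    · simp
    · intro l _ hl; simp [hl]
    · simp
  -- `‖Y e‖ = ‖X e‖` as `Y² = Xᴴ X`, and `R` acts on `e k` as the scalar `p k`.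
  have hnorm : ∀ k, ∑ i, ‖(Y *ᵥ e k) i‖ ^ 2 = p k ^ 2 * quadForm ρ' (e k) := fun k => by
    rw [← quadForm_conjTranspose_mul_self, hYp.isHermitian.eq, hYY,
      quadForm_conjTranspose_mul_self, hX, ← mulVec_mulVec, hRe, ← hSS]
    nth_rewrite 2 [← hSh]
    rw [quadForm_conjTranspose_mul_self, Finset.mul_sum]
    refine Finset.sum_congr rfl fun i _ => ?_
    rw [mulVec_smul, Pi.smul_apply, norm_smul, mul_pow]
    simp
  have hone : ∀ k, ∑ i, ‖e k i‖ ^ 2 = 1 := fun k => by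
    have := he k k
    rw [star_dotProduct_self, if_pos rfl] at this
    exact_mod_cast this
  -- The trace of `Y * P` is `∑ k, ⟨e k|Y|e k⟩`, and each term is at most `‖Y e k‖`.
  rw [← hYP, hP, Finset.mul_sum, trace_sum, Complex.re_sum]
  refine Finset.sum_le_sum fun k _ => ?_
  rw [trace_mul_pureState]
  refine (Complex.re_le_norm _).trans ?_
  have h1 := norm_star_dotProduct_sq_le (e k) (Y *ᵥ e k)
  rw [hone, one_mul, hnorm] at h1
  have h2 := Real.sqrt_le_sqrt h1
  rwa [Real.sqrt_sq (norm_nonneg _), Real.sqrt_mul (sq_nonneg _), Real.sqrt_sq (hp k)] at h2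

lemma sqrt_smul_pureState (u : ι → ℂ) {c n : ℝ} (hc : 0 ≤ c) (hn : 0 < n)
    (hu : ∑ i, ‖u i‖ ^ 2 = n ^ 2) :
    CFC.sqrt ((c ^ 2) • pureState u) = (c / n) • pureState u := by
  refine CFC.sqrt_unique ?_ ?_
  · rw [smul_mul_smul_comm, pureState_mul_pureState, star_dotProduct_self, hu]
    change _ • (((n ^ 2 : ℝ) : ℂ) • pureState u) = _
    rw [Complex.coe_smul, smul_smul]
    congr 1
    field_simp
  · exact smul_nonneg (by positivity) (Matrix.nonneg_iff_posSemidef.2 (pureState_posSemidef _))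

/-- For pure states both square roots are multiples of the states themselves, so the trace norm is
that of a rank-one operator. A zero `ψ` has to be treated apart, since its root is written with a
division by its norm. -/
lemma norm_star_dotProduct_le_fidelity {φ : ι → ℂ} (hφ : ∑ i, ‖φ i‖ ^ 2 = 1) (ψ : ι → ℂ) :
    ‖star φ ⬝ᵥ ψ‖ ≤ fidelity (pureState φ) (pureState ψ) := by
  by_cases hψ : ∑ i, ‖ψ i‖ ^ 2 = 0
  · have : ‖star φ ⬝ᵥ ψ‖ ^ 2 ≤ 0 := by simpa [hψ] using norm_star_dotProduct_sq_le φ ψ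
    have h0 : ‖star φ ⬝ᵥ ψ‖ = 0 := by simpa using le_antisymm this (sq_nonneg _)
    rw [h0]; exact fidelity_nonneg _ _
  set n := √(∑ i, ‖ψ i‖ ^ 2) with hn
  have hnn : ∑ i, ‖ψ i‖ ^ 2 = n ^ 2 := (Real.sq_sqrt (by positivity)).symm
  have hn0 : 0 < n := Real.sqrt_pos.2 (lt_of_le_of_ne (by positivity) (Ne.symm hψ))
  have h1 : CFC.sqrt (pureState φ) = pureState φ := by
    simpa using sqrt_smul_pureState φ zero_le_one one_pos (by simpa using hφ)
  have h2 : CFC.sqrt (pureState ψ) = (1 / n) • pureState ψ := by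
    simpa using sqrt_smul_pureState ψ zero_le_one hn0 hnn
  have h3 : (CFC.sqrt (pureState φ) * CFC.sqrt (pureState ψ))ᴴ *
      (CFC.sqrt (pureState φ) * CFC.sqrt (pureState ψ)) =
      ((‖star φ ⬝ᵥ ψ‖ / n) ^ 2) • pureState ψ := by
    rw [h1, h2, mul_smul_comm, pureState_mul_pureState]
    simp only [conjTranspose_smul, conjTranspose_vecMulVec, star_star, smul_mul_smul_comm,
      vecMulVec_mul_vecMulVec, vecMulVec_smul, star_dotProduct_self, hφ]
    simp only [Complex.ofReal_one, one_smul, star_trivial, RCLike.star_def, Complex.conj_mul']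
    change _ • (((‖star φ ⬝ᵥ ψ‖ : ℂ) ^ 2) • pureState ψ) = _
    rw [← Complex.ofReal_pow, Complex.coe_smul, smul_smul]
    congr 1
    field_simp
  rw [fidelity, traceNorm, h3, sqrt_smul_pureState ψ (by positivity) hn0 hnn, trace_smul,
    trace_pureState, hnn, Complex.real_smul, ← Complex.ofReal_mul, Complex.ofReal_re]
  apply le_of_eq
  field_simp

end MatrixLemmas

noncomputable section

/-! ### Vectors supported on an indexed set of basis elements. -/

section EmbedVec

open Matrix

variable {ι κ ζ : Type*} [Fintype ι] [DecidableEq ι] [Fintype κ] [DecidableEq κ] [Fintype ζ]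
  [DecidableEq ζ]

/-- The vector `∑ z, w z |f z⟩`. -/
def embedVec (f : ζ → ι) (w : ζ → ℂ) : ι → ℂ := fun i => ∑ z, if i = f z then w z else 0

lemma star_embedVec_dotProduct (f : ζ → ι) (w : ζ → ℂ) (x : ι → ℂ) :
    star (embedVec f w) ⬝ᵥ x = ∑ z, star (w z) * x (f z) := by
  simp only [embedVec, dotProduct, Pi.star_apply, star_sum, Finset.sum_mul]
  rw [Finset.sum_comm]
  refine Finset.sum_congr rfl fun z _ => ?_
  rw [Finset.sum_eq_single (f z)]
  · simp
  · intro i _ hi; simp [hi]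
  · simp

lemma embedVec_apply {f : ζ → ι} (hf : Function.Injective f) (w : ζ → ℂ) (z : ζ) :
    embedVec f w (f z) = w z := by
  simp [embedVec, hf.eq_iff]

lemma embedVec_orthonormal {f : κ → ζ → ι} (hf : ∀ k l z z', f k z = f l z' → k = l ∧ z = z')
    {w : ζ → ℝ} (hw : ∑ z, w z ^ 2 = 1) :
    OrthonormalVecs fun k => embedVec (f k) fun z => (w z : ℂ) := by
  intro k l
  simp only [star_embedVec_dotProduct]
  split_ifs with h
  · subst h
    simp only [embedVec_apply (fun z z' h => (hf k k z z' h).2), RCLike.star_def,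
      Complex.conj_ofReal]
    rw [← Complex.ofReal_one, ← hw]
    push_cast
    exact Finset.sum_congr rfl fun z _ => by ring
  · refine Finset.sum_eq_zero fun z _ => ?_
    rw [embedVec, Finset.sum_eq_zero, mul_zero]
    intro z' _
    rw [if_neg fun h' => h (hf _ _ _ _ h').1]

lemma sum_norm_embedVec_sq {f : ζ → ι} (hf : Function.Injective f) (w : ζ → ℂ) :
    ∑ i, ‖embedVec f w i‖ ^ 2 = ∑ z, ‖w z‖ ^ 2 := by
  refine (Fintype.sum_of_injective f hf _ _ (fun i hi => ?_) fun z => ?_).symm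
  · rw [embedVec, Finset.sum_eq_zero]
    · simp
    · intro z _
      rw [if_neg fun h => hi ⟨z, h.symm⟩]
  · rw [embedVec_apply hf]

lemma quadForm_vec_smul (M : Matrix ι ι ℂ) (c : ℂ) (v : ι → ℂ) :
    quadForm M (c • v) = ‖c‖ ^ 2 * quadForm M v := by
  rw [quadForm, mulVec_smul, dotProduct_smul, star_smul, smul_dotProduct, smul_smul, smul_eq_mul,
    RCLike.star_def, Complex.mul_conj', ← Complex.ofReal_pow, Complex.re_ofReal_mul, quadForm]

end EmbedVec

/-! ### The bipartite model of a reduced link state. -/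

/-- The labels and amplitudes of the link state seen from two disjoint systems `S` and `T`. The
labels of the edges inside `S`, between `S` and `T`, between `S` and the rest, between `T` and the
rest, inside `T` and inside the rest are in `α`, `β`, `γ`, `δ`, `ζ` and `η`. -/
structure LinkSystem (α β γ δ ζ η 𝒮 𝒯 : Type*) [Fintype α] [Fintype β] [Fintype γ] [Fintype δ]
    [Fintype ζ] [Fintype η] where
  /-- the basis element of `S` -/
  s : α × β → γ × δ → 𝒮
  /-- the basis element of `T` -/
  t : β × δ → ζ → 𝒯
  s_inj : ∀ y m y' m', s y m = s y' m' → y = y' ∧ m.1 = m'.1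
  t_inj : ∀ k z k' z', t k z = t k' z' → k = k' ∧ z = z'
  /-- amplitudes of the edges touching `S` but not the rest -/
  wY : α × β → ℝ
  /-- amplitudes of the edges between the rest and the two systems -/
  wM : γ × δ → ℝ
  /-- amplitudes of the edges inside `T` -/
  wU : ζ → ℝ
  /-- amplitudes of the edges inside the rest -/
  wH : η → ℝ
  wY_nonneg : ∀ y, 0 ≤ wY y
  wM_nonneg : ∀ m, 0 ≤ wM m
  wY_sum : ∑ y, wY y ^ 2 = 1
  wM_sum : ∑ m, wM m ^ 2 = 1
  wU_sum : ∑ z, wU z ^ 2 = 1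
  wH_sum : ∑ h, wH h ^ 2 = 1

namespace LinkSystem

open Matrix

variable {α β γ δ ζ η 𝒮 𝒯 : Type*} [Fintype α] [Fintype β] [Fintype γ] [Fintype δ]
    [Fintype ζ] [Fintype η] [Fintype 𝒮] [Fintype 𝒯] [DecidableEq α] [DecidableEq β] [DecidableEq γ]
    [DecidableEq δ] [DecidableEq ζ] [DecidableEq η] [DecidableEq 𝒮] [DecidableEq 𝒯]
    (L : LinkSystem α β γ δ ζ η 𝒮 𝒯)

/-- The vector of `T` with given labels of the edges not inside `T`. -/
def vecT (k : β × δ) : 𝒯 → ℂ := embedVec (L.t k) fun z => (L.wU z : ℂ)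

/-- The vector of `S` and `T` with given labels of the edges not inside `T`. -/
def vecST (y : α × β) (m : γ × δ) : 𝒮 × 𝒯 → ℂ :=
  embedVec (fun z => (L.s y m, L.t (y.2, m.2) z)) fun z => (L.wU z : ℂ)

/-- The vector of `S` and `T` with given labels of the edges to the rest. -/
def eigVec (m : γ × δ) : 𝒮 × 𝒯 → ℂ :=
  embedVec (fun p : (α × β) × ζ => (L.s p.1 m, L.t (p.1.2, m.2) p.2))
    fun p => ((L.wY p.1 * L.wU p.2 : ℝ) : ℂ)

/-- The reduced state of the link state. -/
def state : Matrix (𝒮 × 𝒯) (𝒮 × 𝒯) ℂ := ∑ m, (L.wM m ^ 2) • pureState (L.eigVec m)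

/-- The vector of `S` and `T` for an arbitrary amplitude with given labels touching the rest. -/
def ampVec (F : α × β → γ × δ → ζ → η → ℝ) (m : γ × δ) (h : η) : 𝒮 × 𝒯 → ℂ :=
  embedVec (fun p : (α × β) × ζ => (L.s p.1 m, L.t (p.1.2, m.2) p.2))
    fun p => ((F p.1 m p.2 h : ℝ) : ℂ)

/-- The reduced state for an arbitrary amplitude. -/
def ampState (F : α × β → γ × δ → ζ → η → ℝ) : Matrix (𝒮 × 𝒯) (𝒮 × 𝒯) ℂ :=
  ∑ m, ∑ h, pureState (L.ampVec F m h)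

lemma vecT_orthonormal : OrthonormalVecs L.vecT :=
  embedVec_orthonormal (fun _ _ _ _ h => L.t_inj _ _ _ _ h) L.wU_sum

lemma vecST_orthonormal :
    OrthonormalVecs fun p : (α × β) × (γ × δ) => L.vecST p.1 p.2 := by
  refine embedVec_orthonormal (f := fun (p : (α × β) × (γ × δ)) z =>
    (L.s p.1 p.2, L.t (p.1.2, p.2.2) z)) ?_ L.wU_sum
  rintro ⟨y, m⟩ ⟨y', m'⟩ z z' h
  obtain ⟨h1, h2⟩ := Prod.ext_iff.1 h
  obtain ⟨hy, hm⟩ := L.s_inj _ _ _ _ h1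
  obtain ⟨hk, hz⟩ := L.t_inj _ _ _ _ h2
  exact ⟨Prod.ext hy (Prod.ext hm (Prod.ext_iff.1 hk).2), hz⟩

/-- The label `m` can be read off from the basis elements: its first part from `S`, its second from
`T`. Hence the supports are disjoint, and `state` is given by its spectral decomposition. -/
lemma eigVec_orthonormal : OrthonormalVecs L.eigVec := by
  refine embedVec_orthonormal (f := fun m (p : (α × β) × ζ) =>
    (L.s p.1 m, L.t (p.1.2, m.2) p.2)) (w := fun p => L.wY p.1 * L.wU p.2) ?_ ?_
  · rintro m m' ⟨y, z⟩ ⟨y', z'⟩ h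
    obtain ⟨h1, h2⟩ := Prod.ext_iff.1 h
    obtain ⟨hy, hm⟩ := L.s_inj _ _ _ _ h1
    obtain ⟨hk, hz⟩ := L.t_inj _ _ _ _ h2
    exact ⟨Prod.ext hm (Prod.ext_iff.1 hk).2, Prod.ext hy hz⟩
  · simp only [Fintype.sum_prod_type (f := fun p : (α × β) × ζ => _), mul_pow, ← Finset.mul_sum,
      L.wU_sum, mul_one, L.wY_sum]

/-- Each eigenvector is the superposition of the `vecST y m` with amplitudes `wY y`. -/
lemma star_eigVec_dotProduct (m : γ × δ) (x : 𝒮 × 𝒯 → ℂ) :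
    star (L.eigVec m) ⬝ᵥ x = ∑ y, (L.wY y : ℂ) * (star (L.vecST y m) ⬝ᵥ x) := by
  simp only [eigVec, vecST, star_embedVec_dotProduct, Finset.mul_sum]
  rw [Fintype.sum_prod_type]
  refine Finset.sum_congr rfl fun y _ => Finset.sum_congr rfl fun z _ => ?_
  simp [mul_assoc]

lemma trace_state : L.state.trace = 1 := by
  have h : ∀ m, (pureState (L.eigVec m)).trace = 1 := fun m => by
    have := L.eigVec_orthonormal m m
    rw [pureState, trace_vecMulVec, dotProduct_comm, this, if_pos rfl]
  simp only [state, trace_sum, trace_smul, h]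
  rw [← Finset.sum_smul, L.wM_sum, one_smul]

lemma vecST_apply (y : α × β) (m : γ × δ) (a : 𝒮) (b : 𝒯) :
    L.vecST y m (a, b) = if a = L.s y m then L.vecT (y.2, m.2) b else 0 := by
  simp only [vecST, vecT, embedVec, Prod.mk.injEq, ite_and]
  split_ifs <;> simp

/-- The matrix `1 ⊗ σ` is diagonal in the labels of the edges touching `S`. -/
lemma quadForm_one_kronecker_sum_vecST (σ : Matrix 𝒯 𝒯 ℂ) (m : γ × δ) (c : α × β → ℂ) :
    quadForm ((1 : Matrix 𝒮 𝒮 ℂ) ⊗ₖ σ) (∑ y, c y • L.vecST y m) =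
      ∑ y, ‖c y‖ ^ 2 * quadForm σ (L.vecT (y.2, m.2)) := by
  rw [quadForm_one_kronecker]
  -- For fixed `m`, distinct `y` give distinct basis elements of `S`, so the identity on `S` kills
  -- all cross terms.
  have hinj : Function.Injective fun y => L.s y m := fun y y' h => (L.s_inj _ _ _ _ h).1
  have hval : ∀ a, (fun k => (∑ y, c y • L.vecST y m) (a, k)) =
      ∑ y, if a = L.s y m then c y • L.vecT (y.2, m.2) else 0 := by
    intro a
    ext k
    simp only [Finset.sum_apply, Pi.smul_apply, vecST_apply]
    refine Finset.sum_congr rfl fun y _ => ?_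
    split_ifs <;> simp
  simp only [hval]
  refine (Fintype.sum_of_injective (fun y => L.s y m) hinj _ _ (fun a ha => ?_) fun y => ?_).symm
  · rw [Finset.sum_eq_zero]
    · simp [quadForm]
    · intro y _
      rw [if_neg fun h => ha ⟨y, h.symm⟩]
  · rw [Finset.sum_eq_single y]
    · simp [quadForm_vec_smul]
    · intro y' _ hy
      rw [if_neg fun h => hy (hinj h).symm]
    · simp

/-! ### From smoothings to label filters. -/

/-- The joint amplitude of all edges which are neither inside `T` nor inside the rest. -/
def amp (y : α × β) (m : γ × δ) : ℝ := L.wY y * L.wM m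

lemma amp_nonneg (y : α × β) (m : γ × δ) : 0 ≤ L.amp y m :=
  mul_nonneg (L.wY_nonneg y) (L.wM_nonneg m)

lemma sum_amp_sq : ∑ p : (α × β) × (γ × δ), L.amp p.1 p.2 ^ 2 = 1 := by
  simp only [Fintype.sum_prod_type (f := fun p : (α × β) × (γ × δ) => _), amp, mul_pow,
    ← Finset.mul_sum, L.wM_sum, mul_one, L.wY_sum]

/-- A filter `Q` on the labels that loses a weight of at most `2ε`, together with weights `σ` which
certify that the filtered state is bounded by `l • (1 ⊗ σ)`. -/
structure IsFilter (ε l : ℝ) (Q : α × β → γ × δ → ℝ) (σ : β × δ → ℝ) : Prop where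
  nonneg : ∀ y m, 0 ≤ Q y m
  le_one : ∀ y m, Q y m ≤ 1
  loss : ∑ p : (α × β) × (γ × δ), L.amp p.1 p.2 ^ 2 * (1 - Q p.1 p.2) ≤ 2 * ε
  weight_nonneg : ∀ k, 0 ≤ σ k
  weight_sum : ∑ k, σ k ≤ 1
  bound : ∀ m (z : α × β → ℝ),
    (∑ y, Q y m * L.amp y m * z y) ^ 2 ≤ l * ∑ y, z y ^ 2 * σ (y.2, m.2)

/-- The component of a purification of `ρ'` along the basis vector labelled `(y, m)`. -/
def coeff (ρ' : Matrix (𝒮 × 𝒯) (𝒮 × 𝒯) ℂ) (y : α × β) (m : γ × δ) : ℂ :=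
  (star (L.vecST y m) ⬝ᵥ ρ' *ᵥ L.eigVec m) / (√(quadForm ρ' (L.eigVec m)) : ℝ)

/-- Cauchy–Schwarz for the form `ρ'`: with `e = eigVec m`, the operator `ρ'|e⟩⟨e|ρ' / ⟨e|ρ'|e⟩` is
at most `ρ'`. When the denominator vanishes, `coeff` is zero. -/
lemma norm_sum_mul_coeff_sq_le {ρ' : Matrix (𝒮 × 𝒯) (𝒮 × 𝒯) ℂ} (hρ' : ρ'.PosSemidef) (m : γ × δ)
    (c : α × β → ℂ) :
    ‖∑ y, c y * L.coeff ρ' y m‖ ^ 2 ≤ quadForm ρ' (∑ y, star (c y) • L.vecST y m) := by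
  set u := ∑ y, star (c y) • L.vecST y m with hu
  set G := quadForm ρ' (L.eigVec m) with hG
  have hG0 : 0 ≤ G := quadForm_nonneg hρ' _
  have h1 : ∑ y, c y * L.coeff ρ' y m = (star u ⬝ᵥ ρ' *ᵥ L.eigVec m) / (√G : ℝ) := by
    simp only [hu, coeff, star_sum, star_smul, star_star, sum_dotProduct, smul_dotProduct,
      smul_eq_mul, Finset.sum_div, mul_div_assoc]
    rfl
  rw [h1, norm_div, div_pow, Complex.norm_real, Real.norm_eq_abs, sq_abs, Real.sq_sqrt hG0]
  exact div_le_of_le_mul₀ hG0 (quadForm_nonneg hρ' _) (norm_star_dotProduct_mulVec_sq_le hρ' _ _)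

lemma sum_norm_coeff_sq_le {ρ' : Matrix (𝒮 × 𝒯) (𝒮 × 𝒯) ℂ} (hρ' : ρ' ∈ subnormalizedStates _) :
    ∑ p : (α × β) × (γ × δ), ‖L.coeff ρ' p.1 p.2‖ ^ 2 ≤ 1 := by
  refine le_trans ?_ ((L.vecST_orthonormal.sum_quadForm_le_trace hρ'.1).trans hρ'.2)
  refine Finset.sum_le_sum fun p _ => ?_
  have := L.norm_sum_mul_coeff_sq_le hρ'.1 p.2 (Pi.single p.1 1)
  simpa [Pi.single_apply, ite_smul] using this

/-- Superposing the coefficients with amplitudes `wY` restores `⟨e|ρ'|e⟩ / √⟨e|ρ'|e⟩` for `e =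
eigVec m`; the triangle inequality then discards the phases. -/
lemma sqrt_quadForm_eigVec_le {ρ' : Matrix (𝒮 × 𝒯) (𝒮 × 𝒯) ℂ} (hρ' : ρ'.PosSemidef) (m : γ × δ) :
    √(quadForm ρ' (L.eigVec m)) ≤ ∑ y, L.wY y * ‖L.coeff ρ' y m‖ := by
  have h1 : ∑ y, (L.wY y : ℂ) * L.coeff ρ' y m = (√(quadForm ρ' (L.eigVec m)) : ℝ) := by
    simp only [coeff, ← mul_div_assoc, ← Finset.sum_div, ← L.star_eigVec_dotProduct]
    rw [star_dotProduct_mulVec_self hρ', ← Complex.ofReal_div, Real.div_sqrt]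
  have h2 := norm_sum_le Finset.univ fun y => (L.wY y : ℂ) * L.coeff ρ' y m
  rw [h1] at h2
  simpa [abs_of_nonneg (Real.sqrt_nonneg _), abs_of_nonneg (L.wY_nonneg _)] using h2

lemma fidelity_state_le {ρ' : Matrix (𝒮 × 𝒯) (𝒮 × 𝒯) ℂ} (hρ' : ρ'.PosSemidef) :
    fidelity ρ' L.state ≤
      ∑ p : (α × β) × (γ × δ), L.amp p.1 p.2 * ‖L.coeff ρ' p.1 p.2‖ := by
  refine (L.eigVec_orthonormal.fidelity_le L.wM L.wM_nonneg hρ').trans ?_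
  rw [Fintype.sum_prod_type_right' (f := fun y m => L.amp y m * ‖L.coeff ρ' y m‖)]
  refine Finset.sum_le_sum fun m _ => ?_
  refine (mul_le_mul_of_nonneg_left (L.sqrt_quadForm_eigVec_le hρ' m) (L.wM_nonneg m)).trans
    (le_of_eq ?_)
  rw [Finset.mul_sum]
  exact Finset.sum_congr rfl fun y _ => by simp only [amp]; ring

/-- `state` has trace one, so the generalized fidelity is the ordinary one, `F`, and `F² ≥ 1 - ε²`
forces `F ≥ 1 - ε²`. -/
lemma one_sub_sq_le_fidelity {ρ' : Matrix (𝒮 × 𝒯) (𝒮 × 𝒯) ℂ} {ε : ℝ} (hε : 0 ≤ ε)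
    (h : purifiedDistance ρ' L.state ≤ ε) : 1 - ε ^ 2 ≤ fidelity ρ' L.state := by
  rw [purifiedDistance, generalizedFidelity, trace_state] at h
  simp only [Complex.one_re, sub_self, mul_zero, Real.sqrt_zero, add_zero] at h
  have h1 := (Real.sqrt_le_left hε).1 h
  have h2 := fidelity_nonneg ρ' L.state
  by_contra! hlt
  nlinarith [sq_nonneg ε]

/-- Smoothing of the reduced link state can be achieved by filtering the labels. -/
lemma exists_isFilter {ρ' : Matrix (𝒮 × 𝒯) (𝒮 × 𝒯) ℂ} (hρ' : ρ' ∈ subnormalizedStates _) {ε l : ℝ}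
    (hε : 0 ≤ ε) (hl : 0 ≤ l) (hP : purifiedDistance ρ' L.state ≤ ε) {σ : Matrix 𝒯 𝒯 ℂ}
    (hσ : σ ∈ subnormalizedStates 𝒯) (hle : ρ' ≤ l • ((1 : Matrix 𝒮 𝒮 ℂ) ⊗ₖ σ)) :
    ∃ Q w, L.IsFilter ε l Q w := by
  have hr := L.amp_nonneg
  set v := L.coeff ρ' with hv
  -- The filter truncates each amplitude: for positive `amp`, `Q * amp = min amp ‖v‖`.
  set Q : α × β → γ × δ → ℝ := fun y m => min 1 (‖v y m‖ / L.amp y m) with hQ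
  have hQ0 : ∀ y m, 0 ≤ Q y m := fun y m => le_min zero_le_one (div_nonneg (norm_nonneg _) (hr _ _))
  have hQ1 : ∀ y m, Q y m ≤ 1 := fun y m => min_le_left _ _
  have hQv : ∀ y m, Q y m * L.amp y m ≤ ‖v y m‖ := fun y m => by
    refine (mul_le_mul_of_nonneg_right (min_le_right _ _) (hr y m)).trans ?_
    rcases (hr y m).eq_or_lt with h0 | h0
    · simp [← h0]
    · rw [div_mul_cancel₀ _ h0.ne']
  have hpt : ∀ y m, L.amp y m ^ 2 * (1 - Q y m) ≤ L.amp y m * |L.amp y m - ‖v y m‖| := by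
    intro y m
    rcases (hr y m).eq_or_lt with h0 | h0
    · simp [← h0]
    rw [sq, mul_assoc]
    refine mul_le_mul_of_nonneg_left ?_ h0.le
    simp only [hQ]
    rcases le_total 1 (‖v y m‖ / L.amp y m) with h | h
    · rw [min_eq_left h, sub_self, mul_zero]; positivity
    · rw [min_eq_right h, mul_sub, mul_one, mul_div_cancel₀ _ h0.ne']
      exact le_abs_self _
  refine ⟨Q, fun k => quadForm σ (L.vecT k), hQ0, hQ1, ?_, fun k => quadForm_nonneg hσ.1 _,
    (L.vecT_orthonormal.sum_quadForm_le_trace hσ.1).trans hσ.2, fun m z => ?_⟩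
  · rcases le_total 1 ε with hε1 | hε1
    · calc _ ≤ ∑ p : (α × β) × (γ × δ), L.amp p.1 p.2 ^ 2 :=
            Finset.sum_le_sum fun p _ =>
              mul_le_of_le_one_right (sq_nonneg _) (by linarith [hQ0 p.1 p.2])
        _ ≤ 2 * ε := by rw [L.sum_amp_sq]; linarith
    -- Cauchy–Schwarz against the unit vector `amp`: the squared loss is at most `∑ (amp - ‖v‖)² ≤ 2
    -- - 2 (1 - ε²) = 2 ε²`.
    · refine (Finset.sum_le_sum fun p _ => hpt p.1 p.2).trans ?_
      refine abs_le_of_sq_le_sq' (?_ : _ ≤ _) (by linarith) |>.2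
      refine (Finset.sum_mul_sq_le_sq_mul_sq _ _ _).trans ?_
      rw [L.sum_amp_sq, one_mul]
      have hF := (L.one_sub_sq_le_fidelity hε hP).trans (L.fidelity_state_le hρ'.1)
      have hexp : ∑ p : (α × β) × (γ × δ), |L.amp p.1 p.2 - ‖v p.1 p.2‖| ^ 2 =
          1 + ∑ p : (α × β) × (γ × δ), ‖v p.1 p.2‖ ^ 2 -
            2 * ∑ p : (α × β) × (γ × δ), L.amp p.1 p.2 * ‖v p.1 p.2‖ := by
        rw [← L.sum_amp_sq, Finset.mul_sum, ← Finset.sum_add_distrib, ← Finset.sum_sub_distrib]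
        exact Finset.sum_congr rfl fun p _ => by rw [sq_abs]; ring
      rw [hexp]
      nlinarith [L.sum_norm_coeff_sq_le hρ', sq_nonneg ε]
  -- The factors `θ` turn the complex components `v` into the filtered amplitudes. As `‖θ‖ ≤ 1`,
  -- they can be moved into the test vector, where the diagonal form of `1 ⊗ σ` sees only their
  -- moduli.
  · set θ : α × β → ℂ := fun y => (Q y m * L.amp y m : ℝ) / v y m with hθ
    have hθv : ∀ y, θ y * v y m = (Q y m * L.amp y m : ℝ) := fun y => by
      by_cases h : v y m = 0
      · have : Q y m * L.amp y m = 0 :=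
          le_antisymm (by simpa [h] using hQv y m) (mul_nonneg (hQ0 _ _) (hr _ _))
        rw [this]; simp [h]
      · rw [hθ]; exact div_mul_cancel₀ _ h
    have hθ1 : ∀ y, ‖θ y‖ ≤ 1 := fun y => by
      rw [hθ, norm_div, Complex.norm_real, Real.norm_eq_abs,
        abs_of_nonneg (mul_nonneg (hQ0 _ _) (hr _ _))]
      exact div_le_one_of_le₀ (hQv y m) (norm_nonneg _)
    have hsum : ((∑ y, Q y m * L.amp y m * z y : ℝ) : ℂ) = ∑ y, (z y * θ y) * v y m := by
      rw [Complex.ofReal_sum]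
      refine Finset.sum_congr rfl fun y _ => ?_
      rw [mul_assoc (z y : ℂ), hθv, ← Complex.ofReal_mul, mul_comm]
    calc (∑ y, Q y m * L.amp y m * z y) ^ 2
        = ‖∑ y, (z y * θ y) * v y m‖ ^ 2 := by
          rw [← hsum, Complex.norm_real, Real.norm_eq_abs, sq_abs]
      _ ≤ quadForm ρ' (∑ y, star (z y * θ y) • L.vecST y m) :=
          L.norm_sum_mul_coeff_sq_le hρ'.1 m _
      _ ≤ l * ∑ y, ‖star (z y * θ y)‖ ^ 2 * quadForm σ (L.vecT (y.2, m.2)) := by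
          rw [← L.quadForm_one_kronecker_sum_vecST, ← quadForm_smul]
          exact quadForm_mono hle _
      _ ≤ _ := by
          refine mul_le_mul_of_nonneg_left (Finset.sum_le_sum fun y _ => ?_) hl
          refine mul_le_mul_of_nonneg_right ?_ (quadForm_nonneg hσ.1 _)
          rw [norm_star, norm_mul, Complex.norm_real, mul_pow, Real.norm_eq_abs, sq_abs]
          exact mul_le_of_le_one_right (sq_nonneg _) (pow_le_one₀ (norm_nonneg _) (hθ1 y))

lemma IsFilter.mono {L : LinkSystem α β γ δ ζ η 𝒮 𝒯} {ε l l' : ℝ} (hll : l ≤ l')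
    {Q : α × β → γ × δ → ℝ} {σ : β × δ → ℝ} (h : L.IsFilter ε l Q σ) : L.IsFilter ε l' Q σ where
  __ := h
  bound m z := (h.bound m z).trans (mul_le_mul_of_nonneg_right hll
    (Finset.sum_nonneg fun _ _ => mul_nonneg (sq_nonneg _) (h.weight_nonneg _)))

/-- Since `bound` is tested on every `z`, it is an intersection of closed conditions in the filter
and the weights. The formulation by test vectors involves no division by weights, which may vanish.
-/
lemma isCompact_setOf_isFilter (ε l : ℝ) :
    IsCompact {x : (α × β → γ × δ → ℝ) × (β × δ → ℝ) | L.IsFilter ε l x.1 x.2} := by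
  have hK : IsCompact ((Set.univ.pi fun _ : α × β => Set.univ.pi fun _ : γ × δ =>
      Set.Icc (0 : ℝ) 1)
      ×ˢ (Set.univ.pi fun _ : β × δ => Set.Icc (0 : ℝ) 1)) :=
    (isCompact_univ_pi fun _ => isCompact_univ_pi fun _ => isCompact_Icc).prod
      (isCompact_univ_pi fun _ => isCompact_Icc)
  refine hK.of_isClosed_subset ?_ ?_
  · have heq : {x : (α × β → γ × δ → ℝ) × (β × δ → ℝ) | L.IsFilter ε l x.1 x.2} =
      {x | ∀ y m, 0 ≤ x.1 y m} ∩ {x | ∀ y m, x.1 y m ≤ 1} ∩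
      {x | ∑ p : (α × β) × (γ × δ), L.amp p.1 p.2 ^ 2 * (1 - x.1 p.1 p.2) ≤ 2 * ε} ∩
      {x | ∀ k, 0 ≤ x.2 k} ∩ {x | ∑ k, x.2 k ≤ 1} ∩
      {x | ∀ m (z : α × β → ℝ),
        (∑ y, x.1 y m * L.amp y m * z y) ^ 2 ≤ l * ∑ y, z y ^ 2 * x.2 (y.2, m.2)} := by
      ext x
      exact ⟨fun h => ⟨⟨⟨⟨⟨h.1, h.2⟩, h.3⟩, h.4⟩, h.5⟩, h.6⟩,
        fun ⟨⟨⟨⟨⟨h1, h2⟩, h3⟩, h4⟩, h5⟩, h6⟩ => ⟨h1, h2, h3, h4, h5, h6⟩⟩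
    rw [heq]
    simp only [Set.ofPred_forall]
    refine ((((IsClosed.inter ?_ ?_).inter ?_).inter ?_).inter ?_).inter ?_
    · exact isClosed_iInter fun y => isClosed_iInter fun m =>
        isClosed_le (by fun_prop) (by fun_prop)
    · exact isClosed_iInter fun y => isClosed_iInter fun m =>
        isClosed_le (by fun_prop) (by fun_prop)
    · exact isClosed_le (by fun_prop) (by fun_prop)
    · exact isClosed_iInter fun k => isClosed_le (by fun_prop) (by fun_prop)
    · exact isClosed_le (by fun_prop) (by fun_prop)
    · exact isClosed_iInter fun m => isClosed_iInter fun z =>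
        isClosed_le (by fun_prop) (by fun_prop)
  · rintro ⟨Q, σ⟩ h
    refine ⟨fun y _ m _ => ⟨h.nonneg y m, h.le_one y m⟩, fun k _ => ⟨h.weight_nonneg k, ?_⟩⟩
    exact (Finset.single_le_sum (fun k _ => h.weight_nonneg k) (Finset.mem_univ k)).trans
      h.weight_sum

/-- A single filter which is as good as all the smoothings of the link state. -/
lemma exists_optimal_filter {ε : ℝ} (hε : 0 ≤ ε) :
    ∃ (Q : α × β → γ × δ → ℝ) (w : β × δ → ℝ), (∀ y m, 0 ≤ Q y m) ∧ (∀ y m, Q y m ≤ 1) ∧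
      (∑ p : (α × β) × (γ × δ), L.amp p.1 p.2 ^ 2 * (1 - Q p.1 p.2) ≤ 2 * ε) ∧
      ∀ ρ' ∈ subnormalizedStates (𝒮 × 𝒯), purifiedDistance ρ' L.state ≤ ε →
        ∀ σ ∈ subnormalizedStates 𝒯, ∀ l : ℝ, 0 ≤ l → ρ' ≤ l • ((1 : Matrix 𝒮 𝒮 ℂ) ⊗ₖ σ) →
          L.IsFilter ε l Q w := by
  set A : Set ℝ := {l | ∃ Q w, L.IsFilter ε l Q w} with hA
  by_cases hne : Nonempty A
  -- The filter sets shrink as `l` decreases, so a common filter exists for all feasible `l`, even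
  -- if their infimum is not known to be attained.
  · obtain ⟨⟨Q, w⟩, hx⟩ := IsCompact.nonempty_iInter_of_directed_nonempty_isCompact_isClosed
      (fun l : A => {x : (α × β → γ × δ → ℝ) × (β × δ → ℝ) | L.IsFilter ε l x.1 x.2})
      (fun l l' => by
        rcases le_total l l' with h | h
        · exact ⟨l, subset_rfl, fun x hx => IsFilter.mono h hx⟩
        · exact ⟨l', fun x hx => IsFilter.mono h hx, subset_rfl⟩)
      (fun l => by obtain ⟨Q, w, h⟩ := l.2; exact ⟨(Q, w), h⟩)
      (fun l => L.isCompact_setOf_isFilter ε l) (fun l => (L.isCompact_setOf_isFilter ε l).isClosed)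
    rw [Set.mem_iInter] at hx
    have h0 : L.IsFilter ε _ Q w := hx hne.some
    exact ⟨Q, w, h0.nonneg, h0.le_one, h0.loss, fun ρ' hρ' hP σ hσ l hl hle =>
      hx ⟨l, L.exists_isFilter hρ' hε hl hP hσ hle⟩⟩
  -- If no `l` is feasible, no smoothing satisfies an operator bound and the trivial filter will do.
  · refine ⟨fun _ _ => 1, fun _ => 0, fun _ _ => zero_le_one, fun _ _ => le_rfl, by simpa using hε,
      fun ρ' hρ' hP σ hσ l hl hle => ?_⟩
    exact (hne ⟨l, L.exists_isFilter hρ' hε hl hP hσ hle⟩).elim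

/-- The filtered state is bounded, also after filtering further on either side. -/
lemma IsFilter.ampState_le {L : LinkSystem α β γ δ ζ η 𝒮 𝒯} {ε l : ℝ} (hl : 0 ≤ l)
    {Q : α × β → γ × δ → ℝ} {w : β × δ → ℝ} (hQ : L.IsFilter ε l Q w)
    {F : α × β → γ × δ → ζ → η → ℝ} {f₁ : α × β → γ × δ → η → ℝ} {f₂ : β × δ → ζ → ℝ}
    (hf₁ : ∀ y m h, |f₁ y m h| ≤ 1) (hf₂ : ∀ k z, |f₂ k z| ≤ 1)
    (hF : ∀ y m z h, F y m z h =
      Q y m * f₁ y m h * f₂ (y.2, m.2) z * (L.amp y m * L.wU z * L.wH h)) :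
    ∃ σ ∈ subnormalizedStates 𝒯, ∀ l' ≥ l, L.ampState F ≤ l' • ((1 : Matrix 𝒮 𝒮 ℂ) ⊗ₖ σ) := by
  -- The factor `f₂` depends on labels visible in `T` only, so it is built into the vectors that
  -- make up `σ`; `|f₂| ≤ 1` keeps the trace at most one.
  set u : β × δ → 𝒯 → ℂ := fun k => embedVec (L.t k) fun z => ((f₂ k z * L.wU z : ℝ) : ℂ) with hu
  set σ : Matrix 𝒯 𝒯 ℂ := ∑ k, w k • pureState (u k) with hσ
  have hσp : σ.PosSemidef := Matrix.nonneg_iff_posSemidef.1 <| Finset.sum_nonneg fun k _ =>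
    smul_nonneg (hQ.weight_nonneg k) (Matrix.nonneg_iff_posSemidef.2 (pureState_posSemidef _))
  refine ⟨σ, ⟨hσp, ?_⟩, fun l' hll => ?_⟩
  · simp only [hσ, trace_sum, trace_smul, trace_pureState, Complex.re_sum, Complex.real_smul,
      Complex.re_ofReal_mul, Complex.ofReal_re]
    refine le_trans (Finset.sum_le_sum fun k _ => ?_) hQ.weight_sum
    refine mul_le_of_le_one_right (hQ.weight_nonneg k) ?_
    rw [hu, sum_norm_embedVec_sq (fun z z' h => (L.t_inj k z k z' h).2), ← L.wU_sum]
    refine Finset.sum_le_sum fun z _ => ?_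
    rw [Complex.norm_real, Real.norm_eq_abs, sq_abs, mul_pow]
    refine mul_le_of_le_one_left (sq_nonneg _) ?_
    rw [← sq_abs]
    exact pow_le_one₀ (abs_nonneg _) (hf₂ k z)
  refine le_of_quadForm_le ?_ ?_ fun x => ?_
  · exact Matrix.nonneg_iff_posSemidef.1 <| Finset.sum_nonneg fun m _ => Finset.sum_nonneg fun h _ =>
      Matrix.nonneg_iff_posSemidef.2 (pureState_posSemidef _)
  · exact Matrix.nonneg_iff_posSemidef.1 <| smul_nonneg (hl.trans hll)
      (Matrix.nonneg_iff_posSemidef.2 (Matrix.PosSemidef.one.kronecker hσp))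
  set W : α × β → γ × δ → ℝ := fun y m =>
    ‖star (u (y.2, m.2)) ⬝ᵥ fun b => x (L.s y m, b)‖ with hW
  have h1 : ∀ m h, quadForm (pureState (L.ampVec F m h)) x ≤
      L.wH h ^ 2 * (l * ∑ y, W y m ^ 2 * w (y.2, m.2)) := by
    intro m h
    have h2 : star (L.ampVec F m h) ⬝ᵥ x = (L.wH h : ℂ) * ∑ y, ((Q y m * L.amp y m * f₁ y m h : ℝ) : ℂ)
        * (star (u (y.2, m.2)) ⬝ᵥ fun b => x (L.s y m, b)) := by
      simp only [ampVec, hu, star_embedVec_dotProduct, Fintype.sum_prod_type (f := fun p : (α × β) × ζ => _),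
        Finset.mul_sum, hF]
      refine Finset.sum_congr rfl fun y _ => Finset.sum_congr rfl fun z _ => ?_
      simp only [RCLike.star_def, Complex.conj_ofReal]
      push_cast
      ring
    rw [quadForm_pureState, h2, norm_mul, mul_pow, Complex.norm_real, Real.norm_eq_abs, sq_abs]
    -- After the triangle inequality only moduli remain, so `f₁` can be dropped and the bound is
    -- used with the nonnegative test vector `W`.
    refine mul_le_mul_of_nonneg_left (le_trans ?_ (hQ.bound m fun y => W y m)) (sq_nonneg _)
    refine pow_le_pow_left₀ (norm_nonneg _) ((norm_sum_le _ _).trans ?_) 2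
    refine Finset.sum_le_sum fun y _ => ?_
    have h3 : 0 ≤ Q y m * L.amp y m := mul_nonneg (hQ.nonneg y m) (L.amp_nonneg y m)
    rw [norm_mul, Complex.norm_real, Real.norm_eq_abs, abs_mul, abs_of_nonneg h3]
    exact mul_le_mul_of_nonneg_right (mul_le_of_le_one_right h3 (hf₁ y m h)) (norm_nonneg _)
  rw [ampState, quadForm_sum, quadForm_smul, quadForm_one_kronecker]
  have hR0 : 0 ≤ ∑ a, quadForm σ fun b => x (a, b) :=
    Finset.sum_nonneg fun a _ => quadForm_nonneg hσp _
  calc ∑ m, quadForm (∑ h, pureState (L.ampVec F m h)) x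
      ≤ ∑ m, l * ∑ y, W y m ^ 2 * w (y.2, m.2) := by
        refine Finset.sum_le_sum fun m _ => ?_
        rw [quadForm_sum]
        refine (Finset.sum_le_sum fun h _ => h1 m h).trans ?_
        rw [← Finset.sum_mul, L.wH_sum, one_mul]
    _ = l * ∑ p : (α × β) × (γ × δ), W p.1 p.2 ^ 2 * w (p.1.2, p.2.2) := by
        rw [Fintype.sum_prod_type_right' (f := fun y m => W y m ^ 2 * w (y.2, m.2)), Finset.mul_sum]
    _ ≤ l * ∑ a, quadForm σ fun b => x (a, b) := by
        refine mul_le_mul_of_nonneg_left ?_ hl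
        set g : 𝒮 × (β × δ) → ℝ := fun q => w q.2 * ‖star (u q.2) ⬝ᵥ fun b => x (q.1, b)‖ ^ 2 with hg
        have hg0 : ∀ q, 0 ≤ g q := fun q => mul_nonneg (hQ.weight_nonneg _) (sq_nonneg _)
        have h4 : ∑ a, quadForm σ (fun b => x (a, b)) = ∑ q, g q := by
          rw [Fintype.sum_prod_type]
          refine Finset.sum_congr rfl fun a _ => ?_
          simp only [hσ, quadForm_sum, quadForm_smul, quadForm_pureState, hg]
        -- Distinct labels `(y, m)` occupy distinct terms of the form of `1 ⊗ σ`, so one copy of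
        -- that form bounds the sum over all `m`.
        set i : (α × β) × (γ × δ) → 𝒮 × (β × δ) := fun p => (L.s p.1 p.2, (p.1.2, p.2.2)) with hi
        have hinj : Function.Injective i := by
          rintro ⟨y, m⟩ ⟨y', m'⟩ h
          obtain ⟨ha, hb⟩ := Prod.ext_iff.1 h
          obtain ⟨hy, hm⟩ := L.s_inj _ _ _ _ ha
          exact Prod.ext hy (Prod.ext hm (Prod.ext_iff.1 hb).2)
        rw [h4]
        calc _ = ∑ p, g (i p) := Finset.sum_congr rfl fun p _ => mul_comm _ _
          _ = ∑ q ∈ Finset.univ.map ⟨i, hinj⟩, g q := by simp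
          _ ≤ ∑ q, g q :=
            Finset.sum_le_sum_of_subset_of_nonneg (Finset.subset_univ _) fun q _ _ => hg0 q
    _ ≤ _ := mul_le_mul_of_nonneg_right hll hR0

/-- Filtering increases the conditional min-entropy up to the smooth one. -/
lemma exists_filter_smoothCondMinEntropy_le {ε : ℝ} (hε : 0 ≤ ε) :
    ∃ Q : α × β → γ × δ → ℝ, (∀ y m, 0 ≤ Q y m) ∧ (∀ y m, Q y m ≤ 1) ∧
      (∑ p : (α × β) × (γ × δ), L.amp p.1 p.2 ^ 2 * (1 - Q p.1 p.2) ≤ 2 * ε) ∧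
      ∀ (F : α × β → γ × δ → ζ → η → ℝ) (f₁ : α × β → γ × δ → η → ℝ) (f₂ : β × δ → ζ → ℝ),
        (∀ y m h, |f₁ y m h| ≤ 1) → (∀ k z, |f₂ k z| ≤ 1) →
        (∀ y m z h, F y m z h =
          Q y m * f₁ y m h * f₂ (y.2, m.2) z * (L.amp y m * L.wU z * L.wH h)) →
        smoothCondMinEntropy ε L.state ≤ condMinEntropy (L.ampState F) := by
  obtain ⟨Q, w, h0, h1, h2, h⟩ := L.exists_optimal_filter hε
  refine ⟨Q, h0, h1, h2, fun F f₁ f₂ hf₁ hf₂ hF => ?_⟩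
  refine iSup₂_le fun ρ' hρ' => iSup_le fun hP => iSup₂_le fun σ hσ => ?_
  rw [condMinEntropyRel, EReal.neg_le]
  refine le_iInf₂ fun t ht => ?_
  have hl : (0 : ℝ) ≤ 2 ^ t := by positivity
  obtain ⟨σ', hσ', hle⟩ := (h ρ' hρ' hP σ hσ _ hl ht).ampState_le hl hf₁ hf₂ hF
  rw [EReal.neg_le]
  refine le_trans ?_ (le_iSup₂ (f := fun σ _ => condMinEntropyRel (L.ampState F) σ) σ' hσ')
  rw [condMinEntropyRel, EReal.neg_le_neg_iff]
  exact iInf₂_le t (hle _ le_rfl)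

end LinkSystem

end

noncomputable section

/-! ### Edge labels and the link vector. -/

section Labels

variable {V : Type*} [Fintype V] [DecidableEq V] {G : SimpleGraph V} [DecidableRel G.Adj]
  {D : G.edgeSet → ℕ}

variable (D) in
/-- A label for every edge. -/
abbrev EdgeLabels : Type _ := (e : G.edgeSet) → Fin (D e)

/-- The edge has an endpoint in `S`. -/
def Touches (S : Finset V) (e : G.edgeSet) : Prop := ∃ x ∈ (e : Sym2 V), x ∈ S

/-- The basis element of `H_V` in which both half-edges carry the label of their edge. -/
def diag (x : EdgeLabels D) : Config D := fun h => x h.1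

/-- The basis element of `H_S` in which all half-edges carry the label of their edge. -/
def subDiag (S : Finset V) (x : EdgeLabels D) : SubConfig D S := fun h => x h.1.1

lemma diag_injective : Function.Injective (diag (D := D)) := by
  intro x x' h
  ext1 e
  obtain ⟨a, ha⟩ : ∃ a, a ∈ (e : Sym2 V) := by
    induction (e : Sym2 V) with | _ a b => exact ⟨a, by simp⟩
  exact congrFun h ⟨e, a, ha⟩

lemma subDiag_eq_iff (S : Finset V) (x x' : EdgeLabels D) :
    subDiag S x = subDiag S x' ↔ ∀ e, Touches S e → x e = x' e := by
  constructor
  · rintro h e ⟨a, ha, haS⟩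
    exact congrFun h ⟨⟨e, a, ha⟩, haS⟩
  · intro h
    ext1 ⟨⟨e, a, ha⟩, haS⟩
    exact h e ⟨a, ha, haS⟩

lemma join_eq_diag_iff {S T : Finset V} (hST : Disjoint S T) (s : SubConfig D S)
    (t : SubConfig D T) (r : SubConfig D (S ∪ T)ᶜ) (x : EdgeLabels D) :
    join S T s t r = diag x ↔
      s = subDiag S x ∧ t = subDiag T x ∧ r = subDiag (S ∪ T)ᶜ x := by
  constructor
  · intro h
    refine ⟨funext fun ⟨h', hS⟩ => ?_, funext fun ⟨h', hT⟩ => ?_, funext fun ⟨h', hR⟩ => ?_⟩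
    · simpa [join, diag, subDiag, hS] using congrFun h h'
    · have hS : h'.2.1 ∉ S := fun hS => Finset.disjoint_left.1 hST hS hT
      simpa [join, diag, subDiag, hS, hT] using congrFun h h'
    · have hS : h'.2.1 ∉ S := fun hS => by simp [hS] at hR
      have hT : h'.2.1 ∉ T := fun hT => by simp [hT] at hR
      simpa [join, diag, subDiag, hS, hT] using congrFun h h'
  · rintro ⟨rfl, rfl, rfl⟩
    ext1 h
    simp only [join, diag, subDiag]
    split_ifs <;> rfl

/-- The amplitude of `|diag x⟩` in the link state. -/
def linkAmp (lam : (e : G.edgeSet) → Fin (D e) → ℝ) (x : EdgeLabels D) : ℝ :=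
  ∏ e, √(lam e (x e))

/-- The vector `∑ x, f x |diag x⟩`. -/
def diagVec (f : EdgeLabels D → ℝ) : Config D → ℂ := embedVec diag fun x => (f x : ℂ)

/-- Expanding the product over edges of sums over labels gives a sum over label families. -/
lemma linkVector_eq_diagVec (lam : (e : G.edgeSet) → Fin (D e) → ℝ) :
    linkVector lam = diagVec (linkAmp lam) := by
  ext c
  have h : ∀ e : G.edgeSet, edgeVector e (lam e) (fun x => c ⟨e, x⟩) =
      ∑ i, if (fun x => c ⟨e, x⟩) = (fun _ => i) then ((√(lam e i) : ℝ) : ℂ) else 0 := fun e => by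
    simp [edgeVector, Finset.sum_apply, Pi.single_apply]
  simp only [linkVector, h, Finset.prod_univ_sum, Fintype.piFinset_univ, Finset.prod_ite_zero,
    Finset.mem_univ, true_imp_iff, diagVec, embedVec, linkAmp, Complex.ofReal_prod]
  refine Finset.sum_congr rfl fun x _ => if_congr ?_ rfl rfl
  constructor
  · intro h
    ext1 ⟨e, a⟩
    exact congrFun (h e) a
  · rintro rfl e
    rfl

lemma sum_prod_sqrt_sq {I : Type*} [Fintype I] [DecidableEq I] {n : I → ℕ} {l : (i : I) → Fin (n i) → ℝ}
    (h0 : ∀ i j, 0 ≤ l i j) (h1 : ∀ i, ∑ j, l i j = 1) :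
    ∑ x : (i : I) → Fin (n i), (∏ i, √(l i (x i))) ^ 2 = 1 := by
  have h : ∏ i, ∑ j, l i j = 1 := by simp [h1]
  rw [Finset.prod_univ_sum, Fintype.piFinset_univ] at h
  rw [← h]
  refine Finset.sum_congr rfl fun x _ => ?_
  rw [← Finset.prod_pow]
  exact Finset.prod_congr rfl fun i _ => Real.sq_sqrt (h0 _ _)

end Labels

/-! ### Classes of edges relative to `S`, `T` and the rest. -/

section Classes

variable {V : Type*} [Fintype V] [DecidableEq V] {G : SimpleGraph V} [DecidableRel G.Adj]
  {D : G.edgeSet → ℕ} (S T : Finset V)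

open Classical in
/-- The class of an edge: inside `S`, between `S` and `T`, between `S` and the rest, between `T` and
the rest, inside `T`, inside the rest. -/
def edgeClass (e : G.edgeSet) : Fin 6 :=
  if Touches S e then if Touches T e then 1 else if Touches (S ∪ T)ᶜ e then 2 else 0
  else if Touches T e then if Touches (S ∪ T)ᶜ e then 3 else 4 else 5

variable {S T}

lemma touches_or (e : G.edgeSet) : Touches S e ∨ Touches T e ∨ Touches (S ∪ T)ᶜ e := by
  obtain ⟨a, ha⟩ : ∃ a, a ∈ (e : Sym2 V) := by
    induction (e : Sym2 V) with | _ a b => exact ⟨a, by simp⟩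
  by_cases hS : a ∈ S
  · exact Or.inl ⟨a, ha, hS⟩
  by_cases hT : a ∈ T
  · exact Or.inr (Or.inl ⟨a, ha, hT⟩)
  · exact Or.inr (Or.inr ⟨a, ha, by simp [hS, hT]⟩)

/-- An edge has only two endpoints; this makes six classes suffice. -/
lemma not_touches_three (hST : Disjoint S T) (e : G.edgeSet) :
    ¬(Touches S e ∧ Touches T e ∧ Touches (S ∪ T)ᶜ e) := by
  rintro ⟨⟨a, ha, haS⟩, ⟨b, hb, hbT⟩, ⟨c, hc, hcR⟩⟩
  have hab : a ≠ b := fun h => Finset.disjoint_left.1 hST haS (h ▸ hbT)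
  have hca : c ≠ a := fun h => by simp [h, haS] at hcR
  have hcb : c ≠ b := fun h => by simp [h, hbT] at hcR
  rw [((Sym2.mem_and_mem_iff hab).1 ⟨ha, hb⟩), Sym2.mem_iff] at hc
  exact hc.elim hca hcb

lemma touches_left_iff (hST : Disjoint S T) (e : G.edgeSet) :
    Touches S e ↔ edgeClass S T e = 0 ∨ edgeClass S T e = 1 ∨ edgeClass S T e = 2 := by
  have h1 := touches_or (S := S) (T := T) e
  have h2 := not_touches_three hST e
  unfold edgeClass
  split_ifs <;> simp_all

lemma touches_right_iff (hST : Disjoint S T) (e : G.edgeSet) :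
    Touches T e ↔ edgeClass S T e = 1 ∨ edgeClass S T e = 3 ∨ edgeClass S T e = 4 := by
  have h1 := touches_or (S := S) (T := T) e
  have h2 := not_touches_three hST e
  unfold edgeClass
  split_ifs <;> simp_all

lemma touches_compl_iff (hST : Disjoint S T) (e : G.edgeSet) :
    Touches (S ∪ T)ᶜ e ↔ edgeClass S T e = 2 ∨ edgeClass S T e = 3 ∨ edgeClass S T e = 5 := by
  have h1 := touches_or (S := S) (T := T) e
  have h2 := not_touches_three hST e
  unfold edgeClass
  split_ifs <;> simp_all

lemma touches_compl_right_iff (hST : Disjoint S T) (e : G.edgeSet) :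
    Touches Tᶜ e ↔ edgeClass S T e ≠ 4 := by
  have h : Touches Tᶜ e ↔ Touches S e ∨ Touches (S ∪ T)ᶜ e := by
    constructor
    · rintro ⟨a, ha, haT⟩
      rw [Finset.mem_compl] at haT
      by_cases hS : a ∈ S
      · exact Or.inl ⟨a, ha, hS⟩
      · exact Or.inr ⟨a, ha, by simp [hS, haT]⟩
    · rintro (⟨a, ha, hS⟩ | ⟨a, ha, hR⟩)
      · exact ⟨a, ha, Finset.mem_compl.2 (Finset.disjoint_left.1 hST hS)⟩
      · exact ⟨a, ha, by simp at hR; simp [hR]⟩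
  rw [h, touches_left_iff hST, touches_compl_iff hST]
  generalize edgeClass S T e = c
  revert c
  decide

variable (D S T)

/-- The labels of the edges of a class. -/
abbrev ClassLabels (c : Fin 6) : Type _ :=
  (e : {e : G.edgeSet // edgeClass S T e = c}) → Fin (D e.1)

/-- The labels of all edges, by classes. -/
abbrev SplitLabels : Type _ :=
  ((ClassLabels D S T 0 × ClassLabels D S T 1) × (ClassLabels D S T 2 × ClassLabels D S T 3)) ×
    ClassLabels D S T 4 × ClassLabels D S T 5

variable {D S T}

/-- The components of a family of labels by classes. -/
def SplitLabels.comp (p : SplitLabels D S T) (c : Fin 6) : ClassLabels D S T c :=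
  match c with
  | 0 => p.1.1.1
  | 1 => p.1.1.2
  | 2 => p.1.2.1
  | 3 => p.1.2.2
  | 4 => p.2.1
  | 5 => p.2.2

variable (D S T) in
/-- Labels by classes combine to labels of all edges. -/
def glue : SplitLabels D S T ≃ EdgeLabels D where
  toFun p e := p.comp (edgeClass S T e) ⟨e, rfl⟩
  invFun x := (((fun e => x e.1, fun e => x e.1), (fun e => x e.1, fun e => x e.1)),
    (fun e => x e.1, fun e => x e.1))
  left_inv := by
    have h : ∀ (p : SplitLabels D S T) (c : Fin 6) (e : {e : G.edgeSet // edgeClass S T e = c}),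
        p.comp (edgeClass S T e.1) ⟨e.1, rfl⟩ = p.comp c e := by
      rintro p _ ⟨e, rfl⟩; rfl
    intro p
    refine Prod.ext (Prod.ext (Prod.ext ?_ ?_) (Prod.ext ?_ ?_)) (Prod.ext ?_ ?_) <;> ext1 e <;>
      exact h p _ e
  right_inv := by
    intro x
    ext1 e
    have h : ∀ (c : Fin 6) (e : {e : G.edgeSet // edgeClass S T e = c}),
        SplitLabels.comp ((((fun e => x e.1, fun e => x e.1), (fun e => x e.1, fun e => x e.1)),
          (fun e => x e.1, fun e => x e.1)) : SplitLabels D S T) c e = x e.1 := by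
      intro c e
      fin_cases c <;> rfl
    exact h _ _

lemma glue_apply (p : SplitLabels D S T) {c : Fin 6} {e : G.edgeSet} (h : edgeClass S T e = c) :
    glue D S T p e = p.comp c ⟨e, h⟩ := by
  subst h; rfl

/-- Labels agree on the edges of some classes if and only if their components do. -/
lemma glue_eq_on_iff (C : Fin 6 → Prop) (p q : SplitLabels D S T) :
    (∀ e, C (edgeClass S T e) → glue D S T p e = glue D S T q e) ↔
      ∀ c, C c → p.comp c = q.comp c := by
  constructor
  · intro h c hc
    ext1 ⟨e, he⟩
    rw [← glue_apply, ← glue_apply]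
    exact h e (he ▸ hc)
  · intro h e he
    rw [glue_apply p rfl, glue_apply q rfl, h _ he]

lemma subDiag_glue_eq_iff {R : Finset V} (C : Fin 6 → Prop)
    (hC : ∀ e : G.edgeSet, Touches R e ↔ C (edgeClass S T e)) (p q : SplitLabels D S T) :
    subDiag R (glue D S T p) = subDiag R (glue D S T q) ↔ ∀ c, C c → p.comp c = q.comp c := by
  rw [subDiag_eq_iff, ← glue_eq_on_iff]
  simp only [hC]

lemma subDiag_left_iff (hST : Disjoint S T) (p q : SplitLabels D S T) :
    subDiag S (glue D S T p) = subDiag S (glue D S T q) ↔ p.1.1 = q.1.1 ∧ p.1.2.1 = q.1.2.1 := by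
  rw [subDiag_glue_eq_iff (fun c => c = 0 ∨ c = 1 ∨ c = 2) (touches_left_iff hST), Prod.ext_iff]
  simp only [forall_eq_or_imp, forall_eq]
  exact and_assoc.symm

lemma subDiag_right_iff (hST : Disjoint S T) (p q : SplitLabels D S T) :
    subDiag T (glue D S T p) = subDiag T (glue D S T q) ↔
      (p.1.1.2, p.1.2.2) = (q.1.1.2, q.1.2.2) ∧ p.2.1 = q.2.1 := by
  rw [subDiag_glue_eq_iff (fun c => c = 1 ∨ c = 3 ∨ c = 4) (touches_right_iff hST), Prod.mk.injEq]
  simp only [forall_eq_or_imp, forall_eq]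
  exact and_assoc.symm

lemma subDiag_compl_iff (hST : Disjoint S T) (p q : SplitLabels D S T) :
    subDiag (S ∪ T)ᶜ (glue D S T p) = subDiag (S ∪ T)ᶜ (glue D S T q) ↔
      p.1.2 = q.1.2 ∧ p.2.2 = q.2.2 := by
  rw [subDiag_glue_eq_iff (fun c => c = 2 ∨ c = 3 ∨ c = 5) (touches_compl_iff hST), Prod.ext_iff]
  simp only [forall_eq_or_imp, forall_eq]
  exact and_assoc.symm

/-- The amplitude of the edges of a class. -/
def classAmp (lam : (e : G.edgeSet) → Fin (D e) → ℝ) (c : Fin 6) (g : ClassLabels D S T c) : ℝ :=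
  ∏ e, √(lam e.1 (g e))

lemma linkAmp_glue (lam : (e : G.edgeSet) → Fin (D e) → ℝ) (p : SplitLabels D S T) :
    linkAmp lam (glue D S T p) = ∏ c, classAmp lam c (p.comp c) := by
  rw [linkAmp, ← Fintype.prod_fiberwise (edgeClass S T)]
  refine Finset.prod_congr rfl fun c _ => Finset.prod_congr rfl fun e _ => ?_
  rw [glue_apply p e.2]

variable {lam : (e : G.edgeSet) → Fin (D e) → ℝ}

lemma sum_classAmp_sq (h0 : ∀ e i, 0 ≤ lam e i) (h1 : ∀ e, ∑ i, lam e i = 1) (c : Fin 6) :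
    ∑ g : ClassLabels D S T c, classAmp lam c g ^ 2 = 1 :=
  sum_prod_sqrt_sq (l := fun e : {e : G.edgeSet // edgeClass S T e = c} => lam e.1)
    (fun e => h0 e.1) (fun e => h1 e.1)

lemma sum_prod_mul_sq {κ κ' : Type*} [Fintype κ] [Fintype κ'] {f : κ → ℝ} {g : κ' → ℝ}
    (hf : ∑ k, f k ^ 2 = 1) (hg : ∑ k, g k ^ 2 = 1) :
    ∑ p : κ × κ', (f p.1 * g p.2) ^ 2 = 1 := by
  simp only [Fintype.sum_prod_type (f := fun p : κ × κ' => _), mul_pow, ← Finset.mul_sum, hg,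
    mul_one, hf]

/-- The link state seen from two disjoint sets of vertices; `q` only supplies labels for edges on
which nothing depends. -/
def linkSystem (hST : Disjoint S T) (h0 : ∀ e i, 0 ≤ lam e i) (h1 : ∀ e, ∑ i, lam e i = 1)
    (q : SplitLabels D S T) :
    LinkSystem (ClassLabels D S T 0) (ClassLabels D S T 1) (ClassLabels D S T 2)
      (ClassLabels D S T 3) (ClassLabels D S T 4) (ClassLabels D S T 5)
      (SubConfig D S) (SubConfig D T) where
  s y m := subDiag S (glue D S T ((y, m), q.2))
  t k z := subDiag T (glue D S T (((q.1.1.1, k.1), (q.1.2.1, k.2)), (z, q.2.2)))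
  s_inj y m y' m' h := (subDiag_left_iff hST _ _).1 h
  t_inj k z k' z' h := (subDiag_right_iff hST _ _).1 h
  wY y := classAmp lam 0 y.1 * classAmp lam 1 y.2
  wM m := classAmp lam 2 m.1 * classAmp lam 3 m.2
  wU := classAmp lam 4
  wH := classAmp lam 5
  wY_nonneg y := by unfold classAmp; positivity
  wM_nonneg y := by unfold classAmp; positivity
  wY_sum := sum_prod_mul_sq (sum_classAmp_sq h0 h1 _) (sum_classAmp_sq h0 h1 _)
  wM_sum := sum_prod_mul_sq (sum_classAmp_sq h0 h1 _) (sum_classAmp_sq h0 h1 _)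
  wU_sum := sum_classAmp_sq h0 h1 _
  wH_sum := sum_classAmp_sq h0 h1 _

/-! ### Reduced states in terms of the bipartite model. -/

section Reduced

variable (hST : Disjoint S T) (h0 : ∀ e i, 0 ≤ lam e i) (h1 : ∀ e, ∑ i, lam e i = 1)
  (q : SplitLabels D S T)

lemma linkAmp_glue_eq (p : SplitLabels D S T) :
    linkAmp lam (glue D S T p) = (linkSystem hST h0 h1 q).amp p.1.1 p.1.2 *
      (linkSystem hST h0 h1 q).wU p.2.1 * (linkSystem hST h0 h1 q).wH p.2.2 := by
  rw [linkAmp_glue, Fin.prod_univ_six]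
  simp only [LinkSystem.amp, linkSystem, SplitLabels.comp]
  ring

/-- A basis element of the traced-out system determines the labels `m` and `h` of the edges touching
it. Different `(m, h)` therefore do not interfere, and basis elements not arising from labels
contribute zero. -/
lemma reducedState_diagVec (f : EdgeLabels D → ℝ) :
    reducedState (pureState (diagVec f)) S T =
      (linkSystem hST h0 h1 q).ampState fun y m z h => f (glue D S T ((y, m), (z, h))) := by
  set W := linkSystem hST h0 h1 q with hW
  set u : SubConfig D (S ∪ T)ᶜ → SubConfig D S × SubConfig D T → ℂ :=
    fun r p => diagVec f (join S T p.1 p.2 r) with hu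
  have hred : reducedState (pureState (diagVec f)) S T = ∑ r, pureState (u r) := by
    ext p p'
    simp [reducedState, Matrix.sum_apply, pureState, Matrix.vecMulVec_apply, hu]
  have huval : ∀ r p, u r p = ∑ x : SplitLabels D S T,
      if p.1 = subDiag S (glue D S T x) ∧ p.2 = subDiag T (glue D S T x) ∧
        r = subDiag (S ∪ T)ᶜ (glue D S T x) then (f (glue D S T x) : ℂ) else 0 := by
    intro r p
    simp only [hu, diagVec, embedVec, join_eq_diag_iff hST]
    exact (Equiv.sum_comp (glue D S T) _).symm
  set i : (ClassLabels D S T 2 × ClassLabels D S T 3) × ClassLabels D S T 5 →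
      SubConfig D (S ∪ T)ᶜ := fun k => subDiag (S ∪ T)ᶜ (glue D S T ((q.1.1, k.1), (q.2.1, k.2)))
    with hi
  have hinj : Function.Injective i := fun k k' h => by
    obtain ⟨ha, hb⟩ := (subDiag_compl_iff hST _ _).1 h
    exact Prod.ext ha hb
  have hiff : ∀ k (x : SplitLabels D S T), i k = subDiag (S ∪ T)ᶜ (glue D S T x) ↔
      k.1 = x.1.2 ∧ k.2 = x.2.2 := fun k x => subDiag_compl_iff hST _ _
  rw [hred, LinkSystem.ampState, ← Fintype.sum_prod_type' (f := fun m h => pureState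
    (W.ampVec (fun y m z h => f (glue D S T ((y, m), (z, h)))) m h))]
  refine (Fintype.sum_of_injective i hinj _ _ (fun r hr => ?_) fun k => ?_).symm
  · have : u r = 0 := by
      ext p
      rw [huval, Finset.sum_eq_zero, Pi.zero_apply]
      intro x _
      refine if_neg fun h => hr ⟨(x.1.2, x.2.2), ?_⟩
      rw [h.2.2, hiff]
      exact ⟨rfl, rfl⟩
    rw [this]
    ext; simp [pureState, Matrix.vecMulVec_apply]
  · congr 1
    ext p
    rw [huval]
    simp only [hiff, LinkSystem.ampVec, embedVec]
    refine Fintype.sum_of_injective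
      (fun a : (ClassLabels D S T 0 × ClassLabels D S T 1) × ClassLabels D S T 4 =>
        (((a.1, k.1), (a.2, k.2)) : SplitLabels D S T)) ?_ _ _ (fun x hx => ?_) fun a => ?_
    · intro a a' h
      simp only [Prod.mk.injEq] at h
      exact Prod.ext h.1.1 h.2.1
    · refine if_neg fun h => hx ⟨(x.1.1, x.2.1), ?_⟩
      exact Prod.ext (Prod.ext rfl h.2.2.1) (Prod.ext rfl h.2.2.2)
    · have hs : W.s a.1 k.1 = subDiag S (glue D S T ((a.1, k.1), (a.2, k.2))) :=
        (subDiag_left_iff hST _ _).2 ⟨rfl, rfl⟩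
      have ht : W.t (a.1.2, k.1.2) a.2 = subDiag T (glue D S T ((a.1, k.1), (a.2, k.2))) :=
        (subDiag_right_iff hST _ _).2 ⟨rfl, rfl⟩
      refine if_congr ?_ rfl rfl
      rw [Prod.ext_iff, hs, ht]
      simp

lemma reducedState_linkState :
    reducedState (linkState lam) S T = (linkSystem hST h0 h1 q).state := by
  rw [linkState, linkVector_eq_diagVec, reducedState_diagVec hST h0 h1 q]
  simp only [linkAmp_glue_eq hST h0 h1 q]
  set W := linkSystem hST h0 h1 q with hW
  rw [LinkSystem.ampState, LinkSystem.state]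
  refine Finset.sum_congr rfl fun m _ => ?_
  have h : ∀ h, pureState (W.ampVec (fun y m z h => W.amp y m * W.wU z * W.wH h) m h) =
      (W.wH h ^ 2) • ((W.wM m ^ 2) • pureState (W.eigVec m)) := by
    intro h
    have : W.ampVec (fun y m z h => W.amp y m * W.wU z * W.wH h) m h =
        ((W.wH h * W.wM m : ℝ) : ℂ) • W.eigVec m := by
      ext a
      simp only [LinkSystem.ampVec, LinkSystem.eigVec, embedVec, Pi.smul_apply,
        smul_eq_mul, Finset.mul_sum, mul_ite, mul_zero, LinkSystem.amp]
      refine Finset.sum_congr rfl fun b _ => ?_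
      split_ifs
      · push_cast
        ring
      · rfl
    rw [this]
    ext a b
    simp only [pureState, Matrix.vecMulVec_apply, Pi.smul_apply, Pi.star_apply, star_smul,
      Matrix.smul_apply, smul_eq_mul, Complex.real_smul, RCLike.star_def, Complex.conj_ofReal]
    push_cast
    ring
  simp only [h, ← Finset.sum_smul, W.wH_sum, one_smul]

end Reduced

/-- For the bipartition of `S ∪ T` there is a filter on the labels of the edges not inside `T` such
that filtering is as good as smoothing, also after further filtering. -/
lemma exists_labelFilter (hST : Disjoint S T) (h0 : ∀ e i, 0 ≤ lam e i)
    (h1 : ∀ e, ∑ i, lam e i = 1) {ε : ℝ} (hε : 0 ≤ ε) :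
    ∃ Q : EdgeLabels D → ℝ, (∀ x, 0 ≤ Q x) ∧ (∀ x, Q x ≤ 1) ∧ DependsOn Q {e | Touches Tᶜ e} ∧
      (∑ x, linkAmp lam x ^ 2 * (1 - Q x) ≤ 2 * ε) ∧
      ∀ f₁ f₂ : EdgeLabels D → ℝ, (∀ x, |f₁ x| ≤ 1) → (∀ x, |f₂ x| ≤ 1) →
        DependsOn f₁ {e | Touches Tᶜ e} → DependsOn f₂ {e | Touches T e} →
        smoothCondMinEntropy ε (reducedState (linkState lam) S T) ≤
          condMinEntropy (reducedState
            (pureState (diagVec fun x => Q x * f₁ x * f₂ x * linkAmp lam x)) S T) := by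
  -- An empty sum cannot be one; this provides the default labels `q`.
  have hD : ∀ e, Nonempty (Fin (D e)) := fun e => by
    by_contra hne
    rw [not_nonempty_iff] at hne
    simpa using h1 e
  set q : SplitLabels D S T := (glue D S T).symm fun e => (hD e).some with hq
  set W := linkSystem hST h0 h1 q with hW
  obtain ⟨Q, hQ0, hQ1, hloss, hQ⟩ := W.exists_filter_smoothCondMinEntropy_le hε
  have hind : ∀ {f : EdgeLabels D → ℝ}, DependsOn f {e | Touches Tᶜ e} →
      ∀ y m z z' h, f (glue D S T ((y, m), (z, h))) = f (glue D S T ((y, m), (z', h))) := by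
    intro f hf y m z z' h
    refine hf fun e he => ?_
    refine (glue_eq_on_iff (fun c => c ≠ 4) _ _).2 ?_ e ((touches_compl_right_iff hST e).1 he)
    intro c hc
    fin_cases c <;> first | rfl | exact absurd rfl hc
  refine ⟨fun x => Q ((glue D S T).symm x).1.1 ((glue D S T).symm x).1.2, fun x => hQ0 _ _,
    fun x => hQ1 _ _, ?_, ?_, fun f₁ f₂ hf₁ hf₂ hd₁ hd₂ => ?_⟩
  · intro x x' hx
    have h : ∀ {c : Fin 6}, c ≠ 4 → (fun e : {e : G.edgeSet // edgeClass S T e = c} => x e.1) =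
        fun (e : {e : G.edgeSet // edgeClass S T e = c}) => x' e.1 := fun hc =>
      funext fun e => hx e.1 ((touches_compl_right_iff hST e.1).2 fun h => hc (e.2 ▸ h))
    exact congrArg₂ Q (Prod.ext (h (by decide)) (h (by decide)))
      (Prod.ext (h (by decide)) (h (by decide)))
  · rw [← Equiv.sum_comp (glue D S T)]
    simp only [Equiv.symm_apply_apply, linkAmp_glue_eq hST h0 h1 q]
    refine le_trans (le_of_eq ?_) hloss
    rw [Fintype.sum_prod_type]
    refine Finset.sum_congr rfl fun p _ => ?_
    have h3 := sum_prod_mul_sq W.wU_sum W.wH_sum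
    calc _ = ∑ r : ClassLabels D S T 4 × ClassLabels D S T 5,
          (W.amp p.1 p.2 ^ 2 * (1 - Q p.1 p.2)) * (W.wU r.1 * W.wH r.2) ^ 2 :=
          Finset.sum_congr rfl fun r _ => by ring
      _ = _ := by rw [← Finset.mul_sum, h3, mul_one]
  · rw [reducedState_linkState hST h0 h1 q, reducedState_diagVec hST h0 h1 q]
    -- Labels on which `f₁` or `f₂` does not depend are replaced by the defaults.
    refine hQ _ (fun y m h => f₁ (glue D S T ((y, m), (q.2.1, h))))
      (fun k z => f₂ (glue D S T (((q.1.1.1, k.1), (q.1.2.1, k.2)), (z, q.2.2))))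
      (fun _ _ _ => hf₁ _) (fun _ _ => hf₂ _) fun y m z h => ?_
    simp only [Equiv.symm_apply_apply, linkAmp_glue_eq hST h0 h1 q]
    have e2 : f₂ (glue D S T ((y, m), (z, h))) =
        f₂ (glue D S T (((q.1.1.1, y.2), (q.1.2.1, m.2)), (z, q.2.2))) := by
      refine hd₂ fun e he => ?_
      refine (glue_eq_on_iff (fun c => c = 1 ∨ c = 3 ∨ c = 4) _ _).2 ?_ e
        ((touches_right_iff hST e).1 he)
      simp only [forall_eq_or_imp, forall_eq]
      exact ⟨rfl, rfl, rfl⟩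
    rw [hind hd₁ y m z q.2.1 h, e2]

end Classes

end

/-! ### Accumulated loss and purified distance. -/

section

variable {V : Type*} [Fintype V] [DecidableEq V] {G : SimpleGraph V} [DecidableRel G.Adj]
  {D : G.edgeSet → ℕ}

lemma one_sub_prod_le_sum {I : Type*} (s : Finset I) {f : I → ℝ} (h0 : ∀ i ∈ s, 0 ≤ f i)
    (h1 : ∀ i ∈ s, f i ≤ 1) : 1 - ∏ i ∈ s, f i ≤ ∑ i ∈ s, (1 - f i) := by
  classical
  induction s using Finset.induction_on with
  | empty => simp
  | insert a s ha ih =>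
    rw [Finset.prod_insert ha, Finset.sum_insert ha]
    have h2 := ih (fun i hi => h0 i (Finset.mem_insert_of_mem hi))
      fun i hi => h1 i (Finset.mem_insert_of_mem hi)
    have h3 := h0 a (Finset.mem_insert_self a s)
    have h4 := h1 a (Finset.mem_insert_self a s)
    have h5 : ∏ i ∈ s, f i ≤ 1 := Finset.prod_le_one
      (fun i hi => h0 i (Finset.mem_insert_of_mem hi))
      fun i hi => h1 i (Finset.mem_insert_of_mem hi)
    nlinarith

lemma sum_linkAmp_sq {lam : (e : G.edgeSet) → Fin (D e) → ℝ} (h0 : ∀ e i, 0 ≤ lam e i)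
    (h1 : ∀ e, ∑ i, lam e i = 1) : ∑ x, linkAmp lam x ^ 2 = 1 :=
  sum_prod_sqrt_sq h0 h1

lemma sum_norm_diagVec_sq (f : EdgeLabels D → ℝ) : ∑ c, ‖diagVec f c‖ ^ 2 = ∑ x, f x ^ 2 := by
  rw [diagVec, sum_norm_embedVec_sq diag_injective]
  simp

lemma star_diagVec_dotProduct (f g : EdgeLabels D → ℝ) :
    star (diagVec f) ⬝ᵥ diagVec g = ((∑ x, f x * g x : ℝ) : ℂ) := by
  rw [diagVec, diagVec, star_embedVec_dotProduct]
  simp only [embedVec_apply diag_injective, RCLike.star_def, Complex.conj_ofReal]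
  push_cast
  rfl

lemma pureState_mem_subnormalizedStates {ι : Type*} [Fintype ι] [DecidableEq ι] {ψ : ι → ℂ}
    (h : ∑ i, ‖ψ i‖ ^ 2 ≤ 1) : pureState ψ ∈ subnormalizedStates ι :=
  ⟨pureState_posSemidef ψ, by rw [trace_pureState, Complex.ofReal_re]; exact h⟩

/-- `1 - F² ≤ 2 (1 - F)`, and the fidelity `F` is at least the overlap. -/
lemma one_sub_generalizedFidelity_sq_le {ι : Type*} [Fintype ι] [DecidableEq ι] {φ ψ : ι → ℂ}
    (hφ : ∑ i, ‖φ i‖ ^ 2 = 1) {η : ℝ} (h : 1 - ‖star φ ⬝ᵥ ψ‖ ≤ η) :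
    1 - generalizedFidelity (pureState φ) (pureState ψ) ^ 2 ≤ 2 * η := by
  have h1 := norm_star_dotProduct_le_fidelity hφ ψ
  rw [generalizedFidelity, trace_pureState, hφ]
  simp only [Complex.ofReal_one, Complex.one_re, sub_self, zero_mul, Real.sqrt_zero, add_zero]
  nlinarith [sq_nonneg (1 - fidelity (pureState φ) (pureState ψ))]

lemma DependsOn.finset_prod {ι I : Type*} {α : ι → Type*} {s : Set ι} (t : Finset I)
    {f : I → ((i : ι) → α i) → ℝ} (h : ∀ i ∈ t, DependsOn (f i) s) :
    DependsOn (fun x => ∏ i ∈ t, f i x) s := fun _ _ hx =>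
  Finset.prod_congr rfl fun i hi => h i hi hx

end

end LinkStates

theorem mainTheorem8 {V : Type*} [Fintype V] [DecidableEq V] (G : SimpleGraph V)
    [DecidableRel G.Adj] (D : G.edgeSet → ℕ)
    (lam : (e : G.edgeSet) → Fin (D e) → ℝ)
    (hlam_nonneg : ∀ e i, 0 ≤ lam e i) (hlam_sum : ∀ e, ∑ i, lam e i = 1)
    (bdry A Γ : Finset V) (hA : A ⊆ bdry) (hΓ : Γ ∈ cuts bdry A)
    (ε : ℝ) (hε : 0 ≤ ε) :
    ∃ ψ : Config D → ℂ,
      pureState ψ ∈ subnormalizedStates (Config D) ∧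
      purifiedDistance (linkState lam) (pureState ψ) ≤
        2 * (√((smallerCuts bdry A Γ).card : ℝ) + √((largerCuts bdry A Γ).card : ℝ)) * √ε ∧
      (∀ Δ ∈ smallerCuts bdry A Γ,
        smoothCondMinEntropy ε (reducedState (linkState lam) (Γ \ Δ) Γᶜ) ≤
          condMinEntropy (reducedState (pureState ψ) (Γ \ Δ) Γᶜ)) ∧
      (∀ Δ ∈ largerCuts bdry A Γ,
        smoothCondMinEntropy ε (reducedState (linkState lam) (Δ \ Γ) Γ) ≤
          condMinEntropy (reducedState (pureState ψ) (Δ \ Γ) Γ)) := by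
  set C₁ := smallerCuts bdry A Γ
  set C₂ := largerCuts bdry A Γ
  have hd₁ : ∀ Δ, Disjoint (Γ \ Δ) Γᶜ := fun Δ =>
    Finset.disjoint_left.2 fun a ha hb => by simp at ha hb; exact hb ha.1
  have hd₂ : ∀ Δ, Disjoint (Δ \ Γ) Γ := fun Δ => Finset.sdiff_disjoint
  choose P hP0 hP1 hPd hPl hP using fun Δ => exists_labelFilter (hd₁ Δ) hlam_nonneg hlam_sum hε
  choose Q hQ0 hQ1 hQd hQl hQ using fun Δ => exists_labelFilter (hd₂ Δ) hlam_nonneg hlam_sum hε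
  -- Now each `P Δ` reads edges touching `Γ` and each `Q Δ` edges touching `Γᶜ`: exactly the
  -- dependences under which they may serve as further filters for one another.
  rw [compl_compl] at hPd hP
  have hprod : ∀ (R : Finset V → EdgeLabels D → ℝ) (s : Finset (Finset V)), (∀ Δ x, 0 ≤ R Δ x) →
      (∀ Δ x, R Δ x ≤ 1) → ∀ x, 0 ≤ ∏ Δ ∈ s, R Δ x ∧ ∏ Δ ∈ s, R Δ x ≤ 1 := fun R s h0 h1 x =>
    ⟨Finset.prod_nonneg fun Δ _ => h0 Δ x, Finset.prod_le_one (fun Δ _ => h0 Δ x) fun Δ _ => h1 Δ x⟩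
  have habs : ∀ (R : Finset V → EdgeLabels D → ℝ) (s : Finset (Finset V)), (∀ Δ x, 0 ≤ R Δ x) →
      (∀ Δ x, R Δ x ≤ 1) → ∀ x, |∏ Δ ∈ s, R Δ x| ≤ 1 := fun R s h0 h1 x => by
    rw [abs_of_nonneg (hprod R s h0 h1 x).1]; exact (hprod R s h0 h1 x).2
  set f : EdgeLabels D → ℝ := fun x => (∏ Δ ∈ C₁, P Δ x) * ∏ Δ ∈ C₂, Q Δ x with hf
  have hf0 : ∀ x, 0 ≤ f x := fun x =>
    mul_nonneg (hprod P C₁ hP0 hP1 x).1 (hprod Q C₂ hQ0 hQ1 x).1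
  have hf1 : ∀ x, f x ≤ 1 := fun x =>
    mul_le_one₀ (hprod P C₁ hP0 hP1 x).2 (hprod Q C₂ hQ0 hQ1 x).1 (hprod Q C₂ hQ0 hQ1 x).2
  have hnorm := sum_linkAmp_sq hlam_nonneg hlam_sum
  -- This sum is the overlap deficit of the filtered vector; it is subadditive under products of
  -- filters, by `one_sub_prod_le_sum`.
  have hloss : ∑ x, linkAmp lam x ^ 2 * (1 - f x) ≤ 2 * ε * (C₁.card + C₂.card) := by
    have hpt : ∀ x, linkAmp lam x ^ 2 * (1 - f x) ≤ ∑ Δ ∈ C₁, linkAmp lam x ^ 2 * (1 - P Δ x) +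
        ∑ Δ ∈ C₂, linkAmp lam x ^ 2 * (1 - Q Δ x) := fun x => by
      rw [← Finset.mul_sum, ← Finset.mul_sum, ← mul_add]
      refine mul_le_mul_of_nonneg_left ?_ (sq_nonneg _)
      have h1 := one_sub_prod_le_sum C₁ (fun Δ _ => hP0 Δ x) fun Δ _ => hP1 Δ x
      have h2 := one_sub_prod_le_sum C₂ (fun Δ _ => hQ0 Δ x) fun Δ _ => hQ1 Δ x
      have h3 := hprod P C₁ hP0 hP1 x
      have h4 := hprod Q C₂ hQ0 hQ1 x
      simp only [hf]
      nlinarith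
    refine (Finset.sum_le_sum fun x _ => hpt x).trans ?_
    rw [Finset.sum_add_distrib, Finset.sum_comm, Finset.sum_comm (s := Finset.univ) (t := C₂)]
    refine (add_le_add (Finset.sum_le_sum fun Δ _ => hPl Δ)
      (Finset.sum_le_sum fun Δ _ => hQl Δ)).trans (le_of_eq ?_)
    simp only [Finset.sum_const, nsmul_eq_mul]
    ring
  refine ⟨diagVec fun x => f x * linkAmp lam x, ?_, ?_, fun Δ hΔ => ?_, fun Δ hΔ => ?_⟩
  · refine pureState_mem_subnormalizedStates ?_
    rw [sum_norm_diagVec_sq, ← hnorm]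
    refine Finset.sum_le_sum fun x _ => ?_
    rw [mul_pow]
    exact mul_le_of_le_one_left (sq_nonneg _) (pow_le_one₀ (hf0 x) (hf1 x))
  · have hover : 1 - ‖star (diagVec (linkAmp lam)) ⬝ᵥ diagVec fun x => f x * linkAmp lam x‖ ≤
        2 * ε * (C₁.card + C₂.card) := by
      refine le_trans ?_ hloss
      rw [star_diagVec_dotProduct, Complex.norm_real]
      have : ∑ x, linkAmp lam x ^ 2 * (1 - f x) =
          1 - ∑ x, linkAmp lam x * (f x * linkAmp lam x) := by
        simp only [mul_sub, mul_one, Finset.sum_sub_distrib, hnorm]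
        congr 1
        exact Finset.sum_congr rfl fun x _ => by ring
      rw [this]
      exact sub_le_sub_left (Real.le_norm_self _) _
    have h1 : ∑ c, ‖diagVec (linkAmp lam) c‖ ^ 2 = 1 := by rw [sum_norm_diagVec_sq, hnorm]
    rw [purifiedDistance, linkState, linkVector_eq_diagVec, Real.sqrt_le_left (by positivity)]
    -- The squared distance is at most `4 ε (|C₁| + |C₂|)`; the cross term in the square of the
    -- claimed bound is not needed.
    refine (one_sub_generalizedFidelity_sq_le h1 hover).trans ?_
    have hs₁ := Real.sq_sqrt (Nat.cast_nonneg (α := ℝ) C₁.card)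
    have hs₂ := Real.sq_sqrt (Nat.cast_nonneg (α := ℝ) C₂.card)
    have hs₃ := Real.sq_sqrt hε
    have h2 : 0 ≤ √(C₁.card : ℝ) * √(C₂.card : ℝ) * ε := by positivity
    have h3 : (2 * (√(C₁.card : ℝ) + √(C₂.card : ℝ)) * √ε) ^ 2 =
        4 * (√(C₁.card : ℝ) ^ 2 + √(C₂.card : ℝ) ^ 2) * √ε ^ 2 +
          8 * (√(C₁.card : ℝ) * √(C₂.card : ℝ) * √ε ^ 2) := by ring
    rw [h3, hs₁, hs₂, hs₃]
    linarith
  -- Here `T = Γᶜ`: the other smaller cuts supply `f₁`, the larger cuts `f₂`.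
  · have h := hP Δ (fun x => ∏ Δ' ∈ C₁.erase Δ, P Δ' x) (fun x => ∏ Δ' ∈ C₂, Q Δ' x)
      (habs P _ hP0 hP1) (habs Q _ hQ0 hQ1) (DependsOn.finset_prod _ fun Δ' _ => hPd Δ')
      (DependsOn.finset_prod _ fun Δ' _ => hQd Δ')
    have e : (fun x => f x * linkAmp lam x) = fun x =>
        P Δ x * (∏ Δ' ∈ C₁.erase Δ, P Δ' x) * (∏ Δ' ∈ C₂, Q Δ' x) * linkAmp lam x := funext fun x => by
      rw [Finset.mul_prod_erase C₁ (fun Δ' => P Δ' x) hΔ]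
    rw [e]
    exact h
  -- Here `T = Γ`, and the two families exchange roles.
  · have h := hQ Δ (fun x => ∏ Δ' ∈ C₂.erase Δ, Q Δ' x) (fun x => ∏ Δ' ∈ C₁, P Δ' x)
      (habs Q _ hQ0 hQ1) (habs P _ hP0 hP1) (DependsOn.finset_prod _ fun Δ' _ => hQd Δ')
      (DependsOn.finset_prod _ fun Δ' _ => hPd Δ')
    have e : (fun x => f x * linkAmp lam x) = fun x =>
        Q Δ x * (∏ Δ' ∈ C₂.erase Δ, Q Δ' x) * (∏ Δ' ∈ C₁, P Δ' x) * linkAmp lam x := funext fun x => by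
      rw [Finset.mul_prod_erase C₂ (fun Δ' => Q Δ' x) hΔ, mul_comm (∏ Δ' ∈ C₂, Q Δ' x)]
    rw [e]
    exact h
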